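/- **Conventions.** Let $n\ge 0$ be an integer. Work in Lorentz or in split signature: the space of vectors $x^{\alpha\dot\alpha}$ (or $k_{\alpha\dot\alpha}$) is the space of Hermitian, respectively real, $2\times2$ matrices, and for spinors $\kappa,\tilde\kappa\in\mathbb C^2$ write $x\cdot\kappa\tilde\kappa=x^{\alpha\dot\alpha}\kappa_\alpha\tilde\kappa_{\dot\alpha}$. On-shell momentum space is the set of pairs $(\kappa,\tilde\kappa)\in\mathbb C^2\times\mathbb C^2$ for which $k_{\alpha\dot\alpha}=\kappa_\alpha\tilde\kappa_{\dot\alpha}$ is Hermitian, respectively real, and non-zero. Null infinity has homogeneous coordinates $(u,\lambda,\tilde\lambda)$, $u\in\mathbb R$, where $\lambda\ne0$, $\tilde\lambda=\bar\lambda$ in Lorentz signature and $\lambda,\tilde\lambda$ are real with $\lambda_0\tilde\lambda_{\dot0}>0$ in split signature; the rescalings are $(u,\lambda,\tilde\lambda)\mapsto(\alpha\tilde\alpha u,\alpha\lambda,\tilde\alpha\tilde\lambda)$ with $\alpha\neq 0$, $\tilde\alpha=\bar\alpha$, respectively $\alpha,\tilde\alpha$ real with $\alpha\tilde\alpha>0$,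 and $f$ has weights $(p,q)$ if $f(\alpha\tilde\alpha u,\alpha\lambda,\tilde\alpha\tilde\lambda)=\alpha^p\tilde\alpha^q f(u,\lambda,\tilde\lambda)$. Let $z_\alpha=(1,z)$, $\tilde z_{\dot\alpha}=(1,\tilde z)$ with $z\in\mathbb C$, $\tilde z=\bar z$, respectively $z,\tilde z\in\mathbb R$, and let $d^2z$ be Lebesgue measure on $\mathbb C$, respectively $dz\,d\tilde z$ on $\mathbb R^2$. **Negative helicity.** A wave function of helicity $-n/2$ is a continuous function $\hat\phi(\kappa,\tilde\kappa)$ on on-shell momentum space with $\hat\phi(\alpha\kappa,\alpha^{-1}\tilde\kappa)=\alpha^{-n}\hat\phi(\kappa,\tilde\kappa)$ for $\alpha\in\mathbb C^*$, such that $(1+|s|)\,|\hat\phi(\lambda,s\tilde\lambda)|$ is dominated, for $(\lambda,\tilde\lambda)$ in any given compact set and all $s\ne0$, by an integrable function of $s\in\mathbb R$, and such that the following integral converges absolutely. Its massless field is $$\Psi_{\alpha_1\dots\alpha_n}(x)=\frac1{2\pi}\int \kappa_{\alpha_1}\cdots\kappa_{\alpha_n}\,\hat\phi(\kappa,\tilde\kappa)\,e^{-i\,x\cdot\kappa\tilde\kappa}\,\omega\,d\omega\,d^2z,\qquad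 \kappa=\omega^{1/2}z,\ \tilde\kappa=\omega^{1/2}\tilde z,\ \omega\in\mathbb R,$$ where $\omega\,d\omega\,d^2z$ is the residue form $\delta(k^2)\,d^4k$ on the null cone (oriented by $\omega$, so that momenta with $\omega<0$ count with a negative sign). Characteristic data is a function $\Psi^0(u,\lambda,\tilde\lambda)$ on null infinity of weights $(-n-1,-1)$, differentiable in $u$, with $\Psi^0$ and $\partial_u\Psi^0$ jointly continuous and $\Psi^0\to0$ as $u\to\pm\infty$ for fixed $(\lambda,\tilde\lambda)$, such that each $|z_{\alpha_1}\cdots z_{\alpha_n}\,\partial_u\Psi^0(u,z,\tilde z)|$ is bounded, for all $u$, by an integrable function of $(z,\tilde z)$ alone. It is *the radiation data* $\Psi^0_n$ of the field if the Kirchhoff–d'Adhémar formula $$\Psi_{\alpha_1\dots\alpha_n}(x)=\frac1{2\pi}\int z_{\alpha_1}\cdots z_{\alpha_n}\,\partial_u\Psi^0(x\cdot z\tilde z,\,z,\tilde z)\,d^2z$$ holds for all $x$ and all $\alpha_1,\dots,\alpha_n$. **Positive helicity.** The definitions are the same with $\hat\phi(\alpha\kappa,\alpha^{-1}\tilde\kappa)=\alpha^{n}\hat\phi(\kappa,\tilde\kappa)$,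 with $\hat\phi(s\lambda,\tilde\lambda)$ in place of $\hat\phi(\lambda,s\tilde\lambda)$, with $\tilde\kappa_{\dot\alpha_1}\cdots\tilde\kappa_{\dot\alpha_n}$ and $\tilde z_{\dot\alpha_1}\cdots\tilde z_{\dot\alpha_n}$ in place of the undotted products, and with weights $(-1,-n-1)$ of the data, which is denoted $\widetilde\Psi^0_n$. **Lemma.** For every wave function $\hat\phi$ of helicity $-n/2$ radiation data exists, and it is unique and given, at every point $(u,\lambda,\tilde\lambda)$ of null infinity, by the absolutely convergent integrals $$\Psi^0_n(u,\lambda,\tilde\lambda)=i\int_{\mathbb R}\hat\phi(\lambda,s\tilde\lambda)\,e^{-isu}\,ds=i\int_{\mathbb R}s^{n/2}\,\hat\phi(s^{1/2}\lambda,s^{1/2}\tilde\lambda)\,e^{-isu}\,ds .$$ For every wave function $\hat\phi$ of helicity $+n/2$ radiation data exists, and it is unique and given by $$\widetilde\Psi^0_n(u,\lambda,\tilde\lambda)=i\int_{\mathbb R}\hat\phi(s\lambda,\tilde\lambda)\,e^{-isu}\,ds=i\int_{\mathbb R}s^{n/2}\,\hat\phi(s^{1/2}\lambda,s^{1/2}\tilde\lambda)\,e^{-isu}\,ds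 .$$ (Here $s^{1/2}$ is the principal complex square root and $s^{n/2}$ its $n$-th power.) -/

import Mathlib

open MeasureTheory Filter Topology

noncomputable section

namespace NullInfinity

/-- Two-component spinors `κ_α`, `α = 0, 1`. -/
abbrev Spinor := Fin 2 → ℂ

/-- Functions of a pair of momentum spinors `(κ, κ̃)`. -/
abbrev MomentumFunction := Spinor → Spinor → ℂ

/-- Functions `f(u, λ, λ̃)` of the homogeneous coordinates at null infinity. -/
abbrev ScriFunction := ℝ → Spinor → Spinor → ℂ

/-- The two real forms of complexified Minkowski space: Lorentz signature, where the two kinds of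
spinors are related by complex conjugation, and split signature, where all spinors are real. -/
inductive Signature
  | lorentz
  | split

/-- The sign of the helicity `∓ n / 2` of a massless field of spin `n / 2`. -/
inductive HelicitySign
  | neg
  | pos

/-- The real slice of the space of `2 × 2` matrices `x^{αα'}` (or `k_{αα'}`): Hermitian matrices in
Lorentz signature, real matrices in split signature. -/
def IsRealVector : Signature → Matrix (Fin 2) (Fin 2) ℂ → Prop
  | .lorentz, x => x.IsHermitian
  | .split, x => ∀ a b, (x a b).im = 0

/-- The contraction `x^{αα'} κ_α κ̃_{α'}`. -/
def contract (x : Matrix (Fin 2) (Fin 2) ℂ) (k kt : Spinor) : ℂ :=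
  ∑ a, ∑ b, x a b * k a * kt b

/-- Pairs of spinors whose product `k_{αα'} = κ_α κ̃_{α'}` is a non-zero real (automatically null)
momentum. In Lorentz signature these are the pairs `(κ, s κ̄)` with `s` real and non-zero, in split
signature the pairs `(α κ, α⁻¹ κ̃)` with `κ`, `κ̃` real and non-zero and `α` complex and non-zero. -/
def OnShell (sig : Signature) : Set (Spinor × Spinor) :=
  {p | IsRealVector sig (Matrix.vecMulVec p.1 p.2) ∧ Matrix.vecMulVec p.1 p.2 ≠ 0}

/-- The homogeneous coordinates `(λ, λ̃)` of null infinity. In Lorentz signature `λ ≠ 0` and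
`λ̃ = λ̄`. In split signature both are real, in the patch `λ_0 ≠ 0 ≠ λ̃_0` and with signs chosen
such that `λ_0 λ̃_0 > 0`, so that `u` and the Bondi coordinate `u / (λ_0 λ̃_0)` have the same
orientation (in Lorentz signature this is automatic). -/
def Scri : Signature → Set (Spinor × Spinor)
  | .lorentz => {p | p.1 ≠ 0 ∧ p.2 = star p.1}
  | .split => {p | (∀ a, (p.1 a).im = 0) ∧ (∀ a, (p.2 a).im = 0) ∧ 0 < (p.1 0).re * (p.2 0).re}

/-- The scalings `(α, α̃)` that act on the homogeneous coordinates: `α̃ = ᾱ` in Lorentz signature,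
`α`, `α̃` real with `α α̃ > 0` in split signature. -/
def IsScaling : Signature → ℂ → ℂ → Prop
  | .lorentz, a, at' => a ≠ 0 ∧ at' = star a
  | .split, a, at' => a.im = 0 ∧ at'.im = 0 ∧ 0 < a.re * at'.re

/-- The spinors `z_α = (1, z)` and `z̃_{α'} = (1, z̃)`, parametrized by `w ∈ ℂ ≅ ℝ²`: `z = w` and
`z̃ = w̄` in Lorentz signature, `z = Re w` and `z̃ = Im w` in split signature. The area form
`Dλ Dλ̃` is `dz dz̃`, normalized as Lebesgue measure in `w`. -/
def gaugePair : Signature → ℂ → Spinor × Spinor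
  | .lorentz, w => (![1, w], ![1, star w])
  | .split, w => (![1, (w.re : ℂ)], ![1, (w.im : ℂ)])

/-- The momentum spinors `κ = ω^{1/2} z`, `κ̃ = ω^{1/2} z̃`, so that `k_{αα'} = ω z_α z̃_{α'}`; here
`ω` runs through all real numbers. -/
def momentumPair (sig : Signature) (ω : ℝ) (w : ℂ) : Spinor × Spinor :=
  ((ω : ℂ) ^ (1 / 2 : ℂ) • (gaugePair sig w).1, (ω : ℂ) ^ (1 / 2 : ℂ) • (gaugePair sig w).2)

/-- The product `κ_{α₁} ⋯ κ_{αₙ}` (negative helicity) or `κ̃_{α₁'} ⋯ κ̃_{αₙ'}` (positive helicity). -/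
def spinorProduct {n : ℕ} : HelicitySign → Spinor × Spinor → (Fin n → Fin 2) → ℂ
  | .neg, p, A => ∏ i, p.1 (A i)
  | .pos, p, A => ∏ i, p.2 (A i)

/-- Twice the helicity. -/
def helicityWeight (n : ℕ) : HelicitySign → ℤ
  | .neg => -(n : ℤ)
  | .pos => n

/-- The homogeneity weights `(p, q)` of the radiation data. -/
def scriWeights (n : ℕ) : HelicitySign → ℤ × ℤ
  | .neg => (-(n : ℤ) - 1, -1)
  | .pos => (-1, -(n : ℤ) - 1)

/-- The pair `(λ, s λ̃)` for negative helicity, `(s λ, λ̃)` for positive helicity. -/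
def scaledPair : HelicitySign → ℝ → Spinor × Spinor → Spinor × Spinor
  | .neg, s, p => (p.1, (s : ℂ) • p.2)
  | .pos, s, p => ((s : ℂ) • p.1, p.2)

/-- On-shell momentum space wave functions of helicity `∓ n / 2`: functions on on-shell momentum
space whose weight under the little group is twice the helicity, continuous, decaying such that
the energy integrals at null infinity and the on-shell momentum integral converge absolutely, the
former locally uniformly in the direction of the momentum. -/
structure IsWaveFunction (sig : Signature) (h : HelicitySign) (n : ℕ)
    (φ : MomentumFunction) : Prop where
  weight : ∀ p ∈ OnShell sig, ∀ a : ℂ, a ≠ 0 →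
    φ (a • p.1) (a⁻¹ • p.2) = a ^ helicityWeight n h * φ p.1 p.2
  continuousOn : ContinuousOn (fun p : Spinor × Spinor => φ p.1 p.2) (OnShell sig)
  dominated : ∀ K ⊆ Scri sig, IsCompact K → ∃ g : ℝ → ℝ, Integrable g ∧
    ∀ p ∈ K, ∀ s : ℝ, s ≠ 0 →
      (1 + |s|) * ‖φ (scaledPair h s p).1 (scaledPair h s p).2‖ ≤ g s
  integrable : ∀ A : Fin n → Fin 2, Integrable (fun q : ℝ × ℂ =>
    (q.1 : ℂ) * (spinorProduct h (momentumPair sig q.1 q.2) A *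
      φ (momentumPair sig q.1 q.2).1 (momentumPair sig q.1 q.2).2))

/-- The space-time field
`Ψ_{α₁⋯αₙ}(x) = (1/2π) ∫ κ_{α₁} ⋯ κ_{αₙ} φ̂(κ, κ̃) exp(-i x^{αα'} k_{αα'}) δ(k²) d⁴k`
(with `κ̃_{α₁'} ⋯ κ̃_{αₙ'}` for positive helicity). On the null cone, parametrized by
`k_{αα'} = ω z_α z̃_{α'}` with `ω` real, `δ(k²) d⁴k` is the residue 3-form `ω dω dz dz̃`: if `ω m` is
the determinant of `k`, where `m` is added to the component `k_{11'}`, then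
`d⁴k = ω² dω dm dz dz̃ = d(ω m) ω dω dz dz̃` at `m = 0`. -/
def fourierField (sig : Signature) (h : HelicitySign) {n : ℕ} (φ : MomentumFunction)
    (x : Matrix (Fin 2) (Fin 2) ℂ) (A : Fin n → Fin 2) : ℂ :=
  (1 / (2 * Real.pi) : ℂ) * ∫ q : ℝ × ℂ,
    spinorProduct h (momentumPair sig q.1 q.2) A *
      φ (momentumPair sig q.1 q.2).1 (momentumPair sig q.1 q.2).2 *
      Complex.exp (-Complex.I *
        contract x (momentumPair sig q.1 q.2).1 (momentumPair sig q.1 q.2).2) * (q.1 : ℂ)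

/-- The Kirchhoff-d'Adhémar integral
`(1/2π) ∫ λ_{α₁} ⋯ λ_{αₙ} ∂_uΨ⁰(x^{αα'} λ_α λ̃_{α'}, λ, λ̃) Dλ Dλ̃`
(with `λ̃_{α₁'} ⋯ λ̃_{αₙ'}` for positive helicity), evaluated in the gauge `λ_0 = λ̃_0 = 1`. -/
def dAdhemarField (sig : Signature) (h : HelicitySign) {n : ℕ} (Ψ : ScriFunction)
    (x : Matrix (Fin 2) (Fin 2) ℂ) (A : Fin n → Fin 2) : ℂ :=
  (1 / (2 * Real.pi) : ℂ) * ∫ w : ℂ,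
    spinorProduct h (gaugePair sig w) A *
      deriv (fun u => Ψ u (gaugePair sig w).1 (gaugePair sig w).2)
        (contract x (gaugePair sig w).1 (gaugePair sig w).2).re

/-- Characteristic data at null infinity for a massless field of helicity `∓ n / 2`: functions of
the right homogeneity weights, continuously differentiable in `u`, tending to zero at both ends of
every generator of null infinity, for which the Kirchhoff-d'Adhémar integral converges absolutely
and uniformly in `x`. -/
structure IsCharacteristicData (sig : Signature) (h : HelicitySign) (n : ℕ)
    (Ψ : ScriFunction) : Prop where
  weight : ∀ p ∈ Scri sig, ∀ a at' : ℂ, IsScaling sig a at' → ∀ u : ℝ,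
    Ψ ((a * at').re * u) (a • p.1) (at' • p.2) =
      a ^ (scriWeights n h).1 * at' ^ (scriWeights n h).2 * Ψ u p.1 p.2
  differentiable : ∀ p ∈ Scri sig, Differentiable ℝ (fun u => Ψ u p.1 p.2)
  continuousOn : ContinuousOn (fun q : ℝ × (Spinor × Spinor) => Ψ q.1 q.2.1 q.2.2)
    (Set.univ ×ˢ Scri sig)
  continuousOn_deriv : ContinuousOn
    (fun q : ℝ × (Spinor × Spinor) => deriv (fun u => Ψ u q.2.1 q.2.2) q.1)
    (Set.univ ×ˢ Scri sig)
  tendsto_atTop : ∀ p ∈ Scri sig, Tendsto (fun u => Ψ u p.1 p.2) atTop (𝓝 0)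
  tendsto_atBot : ∀ p ∈ Scri sig, Tendsto (fun u => Ψ u p.1 p.2) atBot (𝓝 0)
  dominated : ∀ A : Fin n → Fin 2, ∃ G : ℂ → ℝ, Integrable G ∧ ∀ (u : ℝ) (w : ℂ),
    ‖spinorProduct h (gaugePair sig w) A *
      deriv (fun v => Ψ v (gaugePair sig w).1 (gaugePair sig w).2) u‖ ≤ G w

/-- `Ψ` is the radiation data of the massless field with momentum space wave function `φ`: it is
characteristic data that generates this field through the Kirchhoff-d'Adhémar integral. -/
def IsRadiationDataOf (sig : Signature) (h : HelicitySign) (n : ℕ) (φ : MomentumFunction)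
    (Ψ : ScriFunction) : Prop :=
  IsCharacteristicData sig h n Ψ ∧
    ∀ x, IsRealVector sig x → ∀ A : Fin n → Fin 2,
      fourierField sig h φ x A = dAdhemarField sig h Ψ x A

end NullInfinity

end

open NullInfinity

open NullInfinity

noncomputable section

namespace NullInfinity

/-! Existence is Fourier analysis along the generators. Writing a momentum as `ω z z̃`, the
little-group weight turns the spinor product times the wave function at `ω^{1/2} z`, `ω^{1/2} z̃`
into the product in `z` (or `z̃`) times `energyAmplitude`, and `x·k` into `ω (x·z z̃)`. Integrating
over `ω` first, the factor `ω` of the measure is what `∂_u` produces from `i e^{-iωu}`, so the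
Fourier integral becomes the d'Adhémar integral of `radiationData`. Decay in `u` is the
Riemann–Lebesgue lemma, and the weights come from the little group together with a rescaling of `s`.

Uniqueness is injectivity of a Radon transform. In the gauge `z_0 = z̃_0 = 1` the points `x` with
vanishing `11` entry cut null infinity in all planes `u = t + ⟪b, w⟫`, and the component with all
indices `0` has spinor product `1`. So the difference `h` of the `u`-derivatives of two candidates
has zero integral over every such plane (`IsPlaneNull`). Since `h` is only bounded in `u`, its
Fourier transform in `u` is not directly available. Instead the plane integrals are paired with an
explicit integrable kernel `planeKernel`, whose dual Radon transform is the `u`-derivative of a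
Gaussian up to a constant (`integral_planeKernel`). Translations and independent dilations of `u`
and `w` preserve the class, so Gaussian averages of `h` in `w` do not depend on `u`; shrinking the
Gaussians, neither does `h` (`IsPlaneNull.eq`). This is optimal, since a function of `w` alone with
zero integral is annihilated by all plane integrals. The decay of the data at the ends of the
generators excludes the remaining freedom. -/

/-! ### Gaussian moments -/

/-- The oscillating Gaussian `exp (i t ω - σ ω² / 2)`. -/
def gaussWave (σ t ω : ℝ) : ℂ :=
  Complex.exp (Complex.I * t * ω) * Complex.exp (-((σ : ℂ) / 2) * (ω : ℂ) ^ 2)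

lemma norm_gaussWave (σ t ω : ℝ) : ‖gaussWave σ t ω‖ = Real.exp (-(σ / 2) * ω ^ 2) := by
  have h1 : (Complex.I * t * ω) = ((t * ω : ℝ) : ℂ) * Complex.I := by push_cast; ring
  have h2 : -((σ : ℂ) / 2) * (ω : ℂ) ^ 2 = ((-(σ / 2) * ω ^ 2 : ℝ) : ℂ) := by push_cast; ring
  rw [gaussWave, norm_mul, h1, Complex.norm_exp_ofReal_mul_I, one_mul, h2, ← Complex.ofReal_exp,
    Complex.norm_real, Real.norm_of_nonneg (Real.exp_pos _).le]

lemma integrable_pow_mul_exp_neg_mul_sq (n : ℕ) {b : ℝ} (hb : 0 < b) :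
    Integrable (fun x : ℝ => x ^ n * Real.exp (-b * x ^ 2)) := by
  have := integrable_rpow_mul_exp_neg_mul_sq hb (s := n) (by have := n.cast_nonneg (α := ℝ); linarith)
  simpa using this

lemma integrable_pow_mul_gaussWave (n : ℕ) {σ : ℝ} (hσ : 0 < σ) (t : ℝ) :
    Integrable (fun ω : ℝ => (ω : ℂ) ^ n * gaussWave σ t ω) := by
  refine (integrable_pow_mul_exp_neg_mul_sq n (half_pos hσ)).mono ?_ (ae_of_all _ fun ω => ?_)
  · unfold gaussWave
    exact Continuous.aestronglyMeasurable (by fun_prop)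
  · rw [norm_mul, norm_mul, norm_gaussWave, norm_pow, norm_pow, Complex.norm_real,
      Real.norm_of_nonneg (Real.exp_pos _).le]

lemma hasDerivAt_gaussWave (σ t ω : ℝ) :
    HasDerivAt (gaussWave σ t) ((Complex.I * t - σ * ω) * gaussWave σ t ω) ω := by
  have h0 : HasDerivAt (fun x : ℝ => (x : ℂ)) 1 ω := Complex.ofRealCLM.hasDerivAt
  have h1 := ((h0.const_mul (Complex.I * t)).cexp).mul (((h0.pow 2).const_mul (-((σ : ℂ) / 2))).cexp)
  refine HasDerivAt.congr_deriv (f := gaussWave σ t) h1 ?_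
  simp only [gaussWave, Pi.pow_apply, Nat.cast_ofNat, Nat.add_one_sub_one]
  ring

/-- Integration by parts: the derivative of `ω ^ n * gaussWave σ t ω` integrates to zero. For `n =
0` the truncated exponent `n - 1` is harmless because its coefficient vanishes. -/
lemma integral_pow_succ_mul_gaussWave (n : ℕ) {σ : ℝ} (hσ : 0 < σ) (t : ℝ) :
    (σ : ℂ) * ∫ ω : ℝ, (ω : ℂ) ^ (n + 1) * gaussWave σ t ω =
      (n : ℂ) * (∫ ω : ℝ, (ω : ℂ) ^ (n - 1) * gaussWave σ t ω) +
        Complex.I * t * ∫ ω : ℝ, (ω : ℂ) ^ n * gaussWave σ t ω := by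
  have hd : ∀ ω : ℝ, HasDerivAt (fun ω : ℝ => (ω : ℂ) ^ n * gaussWave σ t ω)
      ((n : ℂ) * ((ω : ℂ) ^ (n - 1) * gaussWave σ t ω) +
        Complex.I * t * ((ω : ℂ) ^ n * gaussWave σ t ω) -
        (σ : ℂ) * ((ω : ℂ) ^ (n + 1) * gaussWave σ t ω)) ω := fun ω => by
    have h0 : HasDerivAt (fun x : ℝ => (x : ℂ)) 1 ω := Complex.ofRealCLM.hasDerivAt
    refine HasDerivAt.congr_deriv (f := fun ω : ℝ => (ω : ℂ) ^ n * gaussWave σ t ω)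
      ((h0.pow n).mul (hasDerivAt_gaussWave σ t ω)) ?_
    simp only [Pi.pow_apply]
    ring
  have i0 := (integrable_pow_mul_gaussWave (n - 1) hσ t).const_mul (n : ℂ)
  have i1 := (integrable_pow_mul_gaussWave n hσ t).const_mul (Complex.I * t)
  have i2 := (integrable_pow_mul_gaussWave (n + 1) hσ t).const_mul (σ : ℂ)
  have := integral_eq_zero_of_hasDerivAt_of_integrable hd ((i0.add i1).sub i2)
    (integrable_pow_mul_gaussWave n hσ t)
  rw [integral_sub (by exact i0.add i1) i2, integral_add i0 i1, integral_const_mul,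
    integral_const_mul, integral_const_mul] at this
  linear_combination -this

lemma integral_gaussWave {σ : ℝ} (hσ : 0 < σ) (t : ℝ) :
    ∫ ω : ℝ, gaussWave σ t ω =
      ((√(2 * Real.pi) * (√σ)⁻¹ * Real.exp (-t ^ 2 / (2 * σ)) : ℝ) : ℂ) := by
  have hb : 0 < ((σ : ℂ) / 2).re := by
    rw [show (σ : ℂ) / 2 = ((σ / 2 : ℝ) : ℂ) by push_cast; ring, Complex.ofReal_re]
    exact half_pos hσ
  have h := fourierIntegral_gaussian hb t
  unfold gaussWave
  rw [h, show (Real.pi : ℂ) / (σ / 2) = ((2 * Real.pi / σ : ℝ) : ℂ) by push_cast; field_simp,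
    show (1 / 2 : ℂ) = ((1 / 2 : ℝ) : ℂ) by push_cast; ring,
    ← Complex.ofReal_cpow (by positivity), ← Real.sqrt_eq_rpow, Real.sqrt_div (by positivity),
    show -(t : ℂ) ^ 2 / (4 * (σ / 2)) = ((-t ^ 2 / (2 * σ) : ℝ) : ℂ) by push_cast; congr 1; ring]
  push_cast
  ring

/-- The density `k(t, b)` on the space of planes `u = t + ⟪b, w⟫` in `ℝ × ℂ` whose dual Radon
transform is `2 π u exp (-(u² + |w|²) / 2)`. -/
def planeKernel (t : ℝ) (b : ℂ) : ℝ :=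
  (3 * t / (1 + ‖b‖ ^ 2) ^ 2 - t ^ 3 / (1 + ‖b‖ ^ 2) ^ 3) * (√(1 + ‖b‖ ^ 2))⁻¹ *
    Real.exp (-t ^ 2 / (2 * (1 + ‖b‖ ^ 2)))

lemma continuous_planeKernel : Continuous (fun q : ℝ × ℂ => planeKernel q.1 q.2) := by
  unfold planeKernel
  fun_prop (disch := first | intro x; positivity | positivity)

lemma integral_gaussWave_one {σ : ℝ} (hσ : 0 < σ) (t : ℝ) :
    ∫ ω : ℝ, (ω : ℂ) * gaussWave σ t ω = Complex.I * t / σ * ∫ ω : ℝ, gaussWave σ t ω := by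
  have h := integral_pow_succ_mul_gaussWave 0 hσ t
  have hσ' : (σ : ℂ) ≠ 0 := by exact_mod_cast hσ.ne'
  simp only [zero_add, pow_one, Nat.cast_zero, zero_mul, pow_zero, one_mul] at h
  field_simp
  linear_combination h

/-- This is where the formula for `planeKernel` comes from: it is the third moment, reduced to the
zeroth by the recursion. The power `ω³` is chosen because the `b`-integration later costs `ω⁻²`. The
power `ω²` would give an undifferentiated Gaussian, but its kernel has `L¹` norm in `t` of order `(1
+ ‖b‖²)⁻¹`, which is not integrable over the plane. -/
lemma integral_cube_mul_gaussWave (t : ℝ) (b : ℂ) :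
    ∫ ω : ℝ, (ω : ℂ) ^ 3 * gaussWave (1 + ‖b‖ ^ 2) t ω =
      Complex.I * √(2 * Real.pi) * planeKernel t b := by
  have hσ : 0 < 1 + ‖b‖ ^ 2 := by positivity
  unfold planeKernel
  set σ := 1 + ‖b‖ ^ 2
  have hσ' : (σ : ℂ) ≠ 0 := by exact_mod_cast hσ.ne'
  have h3 := integral_pow_succ_mul_gaussWave 2 hσ t
  have h2 := integral_pow_succ_mul_gaussWave 1 hσ t
  have h1 := integral_gaussWave_one hσ t
  have h0 := integral_gaussWave hσ t
  simp only [Nat.reduceAdd, Nat.reduceSub, pow_one, pow_zero, one_mul, Nat.cast_one,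
    Nat.cast_ofNat] at h3 h2
  rw [h1] at h2 h3
  set I0 := ∫ ω : ℝ, gaussWave σ t ω
  have h2' : ∫ ω : ℝ, (ω : ℂ) ^ 2 * gaussWave σ t ω = (1 / σ - t ^ 2 / σ ^ 2) * I0 := by
    apply mul_left_cancel₀ hσ'
    rw [h2]
    field_simp
    linear_combination (t : ℂ) ^ 2 * I0 * Complex.I_sq
  rw [h2'] at h3
  apply mul_left_cancel₀ hσ'
  rw [h3]
  have : Complex.I * √(2 * Real.pi) * (((3 * t / σ ^ 2 - t ^ 3 / σ ^ 3) * (√σ)⁻¹ *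
      Real.exp (-t ^ 2 / (2 * σ)) : ℝ) : ℂ) = Complex.I * (3 * t / σ ^ 2 - t ^ 3 / σ ^ 3) * I0 := by
    rw [h0]; push_cast; ring
  rw [this]
  field_simp
  ring

/-! ### Integrability of the kernel -/

lemma integrable_planeKernel_left (b : ℂ) : Integrable (fun t : ℝ => planeKernel t b) := by
  have hσ : 0 < 1 + ‖b‖ ^ 2 := by positivity
  have hb : 0 < 1 / (2 * (1 + ‖b‖ ^ 2)) := by positivity
  have h := ((integrable_pow_mul_exp_neg_mul_sq 1 hb).const_mul
    (3 / (1 + ‖b‖ ^ 2) ^ 2 * (√(1 + ‖b‖ ^ 2))⁻¹)).sub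
    ((integrable_pow_mul_exp_neg_mul_sq 3 hb).const_mul
    (1 / (1 + ‖b‖ ^ 2) ^ 3 * (√(1 + ‖b‖ ^ 2))⁻¹))
  refine h.congr (ae_of_all _ fun t => ?_)
  simp only [Pi.sub_apply, planeKernel]
  rw [show -(1 / (2 * (1 + ‖b‖ ^ 2))) * t ^ 2 = -t ^ 2 / (2 * (1 + ‖b‖ ^ 2)) by ring]
  ring

lemma planeKernel_eq_scaled (t : ℝ) (b : ℂ) :
    planeKernel t b = ((1 + ‖b‖ ^ 2) ^ 2)⁻¹ * planeKernel (t / √(1 + ‖b‖ ^ 2)) 0 := by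
  have hσ : 0 < 1 + ‖b‖ ^ 2 := by positivity
  unfold planeKernel
  set σ := 1 + ‖b‖ ^ 2
  obtain ⟨s, hs, hs2⟩ : ∃ s : ℝ, 0 < s ∧ σ = s ^ 2 :=
    ⟨√σ, Real.sqrt_pos.2 hσ, (Real.sq_sqrt hσ.le).symm⟩
  rw [hs2, Real.sqrt_sq hs.le]
  have : -t ^ 2 / (2 * s ^ 2) = -(t / s) ^ 2 / (2 * (1 + ‖(0 : ℂ)‖ ^ 2)) := by
    simp; field_simp
  rw [this]
  simp
  field_simp

lemma integral_norm_planeKernel (b : ℂ) :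
    ∫ t : ℝ, ‖planeKernel t b‖ =
      (1 + ‖b‖ ^ 2) ^ (-(3 : ℝ) / 2) * ∫ t : ℝ, ‖planeKernel t 0‖ := by
  have hσ : 0 < 1 + ‖b‖ ^ 2 := by positivity
  simp_rw [planeKernel_eq_scaled _ b, norm_mul]
  rw [integral_const_mul, Measure.integral_comp_div (fun t => ‖planeKernel t 0‖), smul_eq_mul,
    ← mul_assoc]
  congr 1
  rw [abs_of_nonneg (Real.sqrt_nonneg _), Real.norm_of_nonneg (by positivity), Real.sqrt_eq_rpow,
    ← Real.rpow_natCast, ← Real.rpow_neg hσ.le, ← Real.rpow_add hσ]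
  norm_num

/-- A shift in `t` does not change the `L¹` norm in `t`, which by scaling is a multiple of `(1 +
‖b‖²)^{-3/2}`; the decay rate `3` exceeds the real dimension `2` of the `b`-plane. -/
lemma integrable_planeKernel_shift {c : ℂ → ℝ} (hc : Continuous c) :
    Integrable (fun q : ℂ × ℝ => planeKernel (q.2 - c q.1) q.1) := by
  have hm : AEStronglyMeasurable (fun q : ℂ × ℝ => planeKernel (q.2 - c q.1) q.1)
      ((volume : Measure ℂ).prod (volume : Measure ℝ)) :=
    (continuous_planeKernel.comp
      (show Continuous fun q : ℂ × ℝ => (q.2 - c q.1, q.1) by fun_prop)).aestronglyMeasurable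
  refine (integrable_prod_iff hm).2 ⟨ae_of_all _ fun b => ?_, ?_⟩
  · exact (integrable_planeKernel_left b).comp_sub_right (c b)
  · have : ∀ b : ℂ, ∫ t : ℝ, ‖planeKernel (t - c b) b‖ =
        (1 + ‖b‖ ^ 2) ^ (-(3 : ℝ) / 2) * ∫ t : ℝ, ‖planeKernel t 0‖ := fun b => by
      rw [integral_sub_right_eq_self (fun t => ‖planeKernel t b‖) (c b),
        integral_norm_planeKernel]
    simp only [this]
    exact (integrable_rpow_neg_one_add_norm_sq (by simp; norm_num)).mul_const _

/-! ### The dual Radon transform of the kernel -/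

/-- For fixed `ω` the whole `b`-dependence is a Gaussian times a plane wave, so the `b`-integral is
elementary. -/
lemma gaussWave_split (u ω : ℝ) (w b : ℂ) :
    (ω : ℂ) ^ 3 * gaussWave (1 + ‖b‖ ^ 2) (u - inner ℝ w b) ω =
      ((ω : ℂ) ^ 3 * gaussWave 1 u ω) *
        Complex.exp (-((ω : ℂ) ^ 2 / 2) * (‖b‖ : ℂ) ^ 2 +
          -(Complex.I * ω) * ((inner ℝ w b : ℝ) : ℂ)) := by
  unfold gaussWave
  rw [mul_assoc, mul_assoc]
  congr 1
  rw [← Complex.exp_add, ← Complex.exp_add, ← Complex.exp_add]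
  congr 1
  push_cast
  ring

lemma integral_gauss_plane {ω : ℝ} (hω : ω ≠ 0) (w : ℂ) :
    ∫ b : ℂ, Complex.exp (-((ω : ℂ) ^ 2 / 2) * (‖b‖ : ℂ) ^ 2 +
          -(Complex.I * ω) * ((inner ℝ w b : ℝ) : ℂ)) =
      2 * Real.pi / (ω : ℂ) ^ 2 * Complex.exp (-(‖w‖ : ℂ) ^ 2 / 2) := by
  have hω' : (ω : ℂ) ≠ 0 := by exact_mod_cast hω
  have hb : 0 < ((ω : ℂ) ^ 2 / 2).re := by
    rw [show (ω : ℂ) ^ 2 / 2 = ((ω ^ 2 / 2 : ℝ) : ℂ) by push_cast; ring, Complex.ofReal_re]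
    positivity
  rw [GaussianFourier.integral_cexp_neg_mul_sq_norm_add hb (-(Complex.I * ω)) w]
  rw [Complex.finrank_real_complex]
  norm_num
  rw [show (Complex.I * ω) ^ 2 * (‖w‖ : ℂ) ^ 2 / (4 * ((ω : ℂ) ^ 2 / 2)) = -(‖w‖ : ℂ) ^ 2 / 2 by
    rw [mul_pow, Complex.I_sq]; field_simp; norm_num]
  congr 1
  field_simp

lemma integrable_gauss_plane {ω : ℝ} (hω : ω ≠ 0) (w : ℂ) :
    Integrable (fun b : ℂ => Complex.exp (-((ω : ℂ) ^ 2 / 2) * (‖b‖ : ℂ) ^ 2 +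
          -(Complex.I * ω) * ((inner ℝ w b : ℝ) : ℂ))) := by
  have hb : 0 < ((ω : ℂ) ^ 2 / 2).re := by
    rw [show (ω : ℂ) ^ 2 / 2 = ((ω ^ 2 / 2 : ℝ) : ℂ) by push_cast; ring, Complex.ofReal_re]
    positivity
  exact GaussianFourier.integrable_cexp_neg_mul_sq_norm_add hb (-(Complex.I * ω)) w

/-- The `w`-dependent factor is a pure phase, so the modulus is the integrand at `w = 0`. -/
lemma integral_norm_gauss_plane {ω : ℝ} (hω : ω ≠ 0) (w : ℂ) :
    ∫ b : ℂ, ‖Complex.exp (-((ω : ℂ) ^ 2 / 2) * (‖b‖ : ℂ) ^ 2 +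
          -(Complex.I * ω) * ((inner ℝ w b : ℝ) : ℂ))‖ = 2 * Real.pi / ω ^ 2 := by
  have h := integral_gauss_plane hω 0
  have : ∀ b : ℂ, Complex.exp (-((ω : ℂ) ^ 2 / 2) * (‖b‖ : ℂ) ^ 2 +
          -(Complex.I * ω) * ((inner ℝ (0 : ℂ) b : ℝ) : ℂ)) =
      ((‖Complex.exp (-((ω : ℂ) ^ 2 / 2) * (‖b‖ : ℂ) ^ 2 +
          -(Complex.I * ω) * ((inner ℝ w b : ℝ) : ℂ))‖ : ℝ) : ℂ) := fun b => by
    rw [Complex.norm_exp, Complex.ofReal_exp]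
    congr 1
    rw [inner_zero_left]
    apply Complex.ext <;> simp [← Complex.ofReal_pow]
  simp_rw [this] at h
  rw [integral_complex_ofReal] at h
  rw [norm_zero, Complex.ofReal_zero, zero_pow two_ne_zero, neg_zero, zero_div, Complex.exp_zero,
    mul_one] at h
  exact_mod_cast h

/-- Integrating the modulus over `b` leaves `2π |ω| exp(-ω²/2)`: the singular `ω⁻²` is absorbed by
`|ω|³`. -/
lemma integrable_gaussWave_prod (u : ℝ) (w : ℂ) :
    Integrable (fun q : ℝ × ℂ =>
      (q.1 : ℂ) ^ 3 * gaussWave (1 + ‖q.2‖ ^ 2) (u - inner ℝ w q.2) q.1)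
      ((volume : Measure ℝ).prod (volume : Measure ℂ)) := by
  have hm : AEStronglyMeasurable (fun q : ℝ × ℂ =>
      (q.1 : ℂ) ^ 3 * gaussWave (1 + ‖q.2‖ ^ 2) (u - inner ℝ w q.2) q.1)
      ((volume : Measure ℝ).prod (volume : Measure ℂ)) := by
    unfold gaussWave
    exact Continuous.aestronglyMeasurable (by fun_prop)
  have hne : ∀ᵐ ω : ℝ, ω ≠ 0 := by
    simp [ae_iff]
  refine (integrable_prod_iff hm).2 ⟨?_, ?_⟩
  · filter_upwards [hne] with ω hω
    simp_rw [gaussWave_split]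
    exact (integrable_gauss_plane hω w).const_mul _
  · refine ((integrable_pow_mul_gaussWave 1 one_pos u).norm.const_mul (2 * Real.pi)).congr ?_
    filter_upwards [hne] with ω hω
    simp_rw [gaussWave_split, norm_mul]
    rw [integral_const_mul, integral_norm_gauss_plane hω]
    simp only [norm_pow, Complex.norm_real, Real.norm_eq_abs]
    rw [← sq_abs ω]
    have : |ω| ≠ 0 := abs_ne_zero.2 hω
    field_simp

/-- Write the kernel as a third Gaussian moment and integrate over `b` first. This produces `2π ω⁻²
exp(-‖w‖²/2)`, and the surviving first moment in `ω` is the derivative of a Gaussian in `u`. -/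
theorem integral_planeKernel (u : ℝ) (w : ℂ) :
    ∫ b : ℂ, planeKernel (u - inner ℝ w b) b =
      2 * Real.pi * (u * Real.exp (-u ^ 2 / 2)) * Real.exp (-‖w‖ ^ 2 / 2) := by
  have hswap := integral_integral_swap
    (f := fun (ω : ℝ) (b : ℂ) => (ω : ℂ) ^ 3 * gaussWave (1 + ‖b‖ ^ 2) (u - inner ℝ w b) ω)
    (integrable_gaussWave_prod u w)
  simp_rw [integral_cube_mul_gaussWave] at hswap
  rw [integral_const_mul, integral_complex_ofReal] at hswap
  have hne : ∀ᵐ ω : ℝ, ω ≠ 0 := by simp [ae_iff]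
  have hl : ∫ ω : ℝ, ∫ b : ℂ, (ω : ℂ) ^ 3 * gaussWave (1 + ‖b‖ ^ 2) (u - inner ℝ w b) ω =
      ∫ ω : ℝ, (2 * Real.pi * Complex.exp (-(‖w‖ : ℂ) ^ 2 / 2)) * ((ω : ℂ) * gaussWave 1 u ω) := by
    refine integral_congr_ae ?_
    filter_upwards [hne] with ω hω
    have hω' : (ω : ℂ) ≠ 0 := by exact_mod_cast hω
    simp_rw [gaussWave_split]
    rw [integral_const_mul, integral_gauss_plane hω]
    field_simp
  rw [hl, integral_const_mul, integral_gaussWave_one one_pos, integral_gaussWave one_pos] at hswap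
  have hs : ((√(2 * Real.pi) : ℝ) : ℂ) ≠ 0 := by
    exact_mod_cast (Real.sqrt_pos.2 (by positivity)).ne'
  have hI : Complex.I * ((√(2 * Real.pi) : ℝ) : ℂ) ≠ 0 := mul_ne_zero Complex.I_ne_zero hs
  apply Complex.ofReal_injective
  apply mul_left_cancel₀ hI
  rw [← hswap]
  push_cast
  simp
  ring

/-! ### Injectivity of the Radon transform over the planes `u = t + ⟪b, w⟫` -/

/-- Continuous functions on `ℝ × ℂ`, dominated by an integrable function of the second variable,
whose integrals over all planes `u = t + ⟪b, w⟫` vanish. -/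
structure IsPlaneNull (h : ℝ → ℂ → ℂ) : Prop where
  continuous : Continuous (fun q : ℝ × ℂ => h q.1 q.2)
  dominated : ∃ G : ℂ → ℝ, Integrable G ∧ ∀ u w, ‖h u w‖ ≤ G w
  integral_eq_zero : ∀ (t : ℝ) (b : ℂ), ∫ w : ℂ, h (t + inner ℝ b w) w = 0

lemma integral_comp_affine (f : ℂ → ℂ) (w₀ : ℂ) (c : ℝ) :
    ∫ w : ℂ, f (w₀ + c • w) = |(c ^ 2)⁻¹| • ∫ w : ℂ, f w := by
  rw [Measure.integral_comp_smul volume (fun v => f (w₀ + v)) c, Complex.finrank_real_complex,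
    integral_add_left_eq_self]

/-- Planes go to planes: the slope `b` becomes `(a / c) b` and the intercept is adjusted. This
symmetry extends results for one Gaussian to all centres and widths. -/
lemma IsPlaneNull.comp_affine {h : ℝ → ℂ → ℂ} (hh : IsPlaneNull h) (u₀ a : ℝ) (w₀ : ℂ) {c : ℝ}
    (hc : c ≠ 0) : IsPlaneNull (fun u w => h (u₀ + a * u) (w₀ + c • w)) where
  continuous := hh.continuous.comp
    (show Continuous fun q : ℝ × ℂ => (u₀ + a * q.1, w₀ + c • q.2) by fun_prop)
  dominated := by
    obtain ⟨G, hG, hle⟩ := hh.dominated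
    exact ⟨fun w => G (w₀ + c • w), (hG.comp_add_left w₀).comp_smul hc, fun u w => hle _ _⟩
  integral_eq_zero t b := by
    have h1 := integral_comp_affine (fun v => h ((u₀ + a * t - inner ℝ ((a / c) • b) w₀) +
      inner ℝ ((a / c) • b) v) v) w₀ c
    rw [hh.integral_eq_zero, smul_zero] at h1
    rw [← h1]
    refine integral_congr_ae (ae_of_all _ fun w => ?_)
    simp only
    congr 1
    simp only [inner_add_right, inner_smul_left, inner_smul_right]
    simp only [conj_trivial]
    field_simp
    ring

/-- Duality for the Radon transform: the vanishing plane integrals are weighted with `planeKernel`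
and the order of integration is exchanged, so that `h` is tested against the dual transform of the
kernel. The integrable kernel times the bound `G` justifies Fubini although `h` need not decay in
`u`. -/
lemma IsPlaneNull.integral_gauss {h : ℝ → ℂ → ℂ} (hh : IsPlaneNull h) :
    ∫ u : ℝ, ((u * Real.exp (-u ^ 2 / 2) : ℝ) : ℂ) *
      ∫ w : ℂ, (Real.exp (-‖w‖ ^ 2 / 2) : ℂ) * h u w = 0 := by
  obtain ⟨G, hG, hle⟩ := hh.dominated
  have hk := integrable_planeKernel_shift (c := fun _ => 0) continuous_const
  simp only [sub_zero] at hk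
  have hcont := hh.continuous
  have hpc := continuous_planeKernel
  -- the integral of the plane integrals against the kernel
  have i1 : Integrable (fun q : (ℂ × ℝ) × ℂ =>
      (planeKernel q.1.2 q.1.1 : ℂ) * h (q.1.2 + inner ℝ q.1.1 q.2) q.2)
      ((volume : Measure (ℂ × ℝ)).prod (volume : Measure ℂ)) := by
    refine (hk.norm.mul_prod hG).mono' ?_ (ae_of_all _ fun q => ?_)
    · refine Continuous.aestronglyMeasurable (Continuous.mul ?_ ?_)
      · exact Complex.continuous_ofReal.comp (hpc.comp
          (show Continuous fun q : (ℂ × ℝ) × ℂ => (q.1.2, q.1.1) by fun_prop))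
      · exact hcont.comp (show Continuous fun q : (ℂ × ℝ) × ℂ =>
          (q.1.2 + inner ℝ q.1.1 q.2, q.2) by fun_prop)
    · rw [norm_mul, Complex.norm_real]
      exact mul_le_mul_of_nonneg_left (hle _ _) (norm_nonneg _)
  have hz : ∫ w : ℂ, ∫ p : ℂ × ℝ, (planeKernel p.2 p.1 : ℂ) * h (p.2 + inner ℝ p.1 w) w = 0 := by
    rw [← integral_integral_swap i1]
    simp_rw [integral_const_mul, hh.integral_eq_zero]
    simp
  have hinner : ∀ w : ℂ, ∫ p : ℂ × ℝ, (planeKernel p.2 p.1 : ℂ) * h (p.2 + inner ℝ p.1 w) w =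
      ∫ u : ℝ, ((2 * Real.pi * (u * Real.exp (-u ^ 2 / 2)) * Real.exp (-‖w‖ ^ 2 / 2) : ℝ) : ℂ) *
        h u w := fun w => by
    have j1 : Integrable (fun p : ℂ × ℝ =>
        (planeKernel p.2 p.1 : ℂ) * h (p.2 + inner ℝ p.1 w) w) := by
      refine (hk.norm.mul_const (G w)).mono' ?_ (ae_of_all _ fun p => ?_)
      · refine Continuous.aestronglyMeasurable (Continuous.mul ?_ ?_)
        · exact Complex.continuous_ofReal.comp (hpc.comp
            (show Continuous fun q : ℂ × ℝ => (q.2, q.1) by fun_prop))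
        · exact hcont.comp (show Continuous fun q : ℂ × ℝ =>
            (q.2 + inner ℝ q.1 w, w) by fun_prop)
      · rw [norm_mul, Complex.norm_real]
        exact mul_le_mul_of_nonneg_left (hle _ _) (norm_nonneg _)
    have j2 : Integrable (fun p : ℂ × ℝ =>
        (planeKernel (p.2 - inner ℝ w p.1) p.1 : ℂ) * h p.2 w) := by
      refine ((integrable_planeKernel_shift (c := fun b => inner ℝ w b)
        (by fun_prop)).norm.mul_const (G w)).mono' ?_ (ae_of_all _ fun p => ?_)
      · refine Continuous.aestronglyMeasurable (Continuous.mul ?_ ?_)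
        · exact Complex.continuous_ofReal.comp (hpc.comp
            (show Continuous fun q : ℂ × ℝ => (q.2 - inner ℝ w q.1, q.1) by fun_prop))
        · exact hcont.comp (show Continuous fun q : ℂ × ℝ => (q.2, w) by fun_prop)
      · rw [norm_mul, Complex.norm_real]
        exact mul_le_mul_of_nonneg_left (hle _ _) (norm_nonneg _)
    rw [Measure.volume_eq_prod] at j1 j2 ⊢
    rw [integral_prod _ j1]
    have : ∀ b : ℂ, ∫ t : ℝ, (planeKernel t b : ℂ) * h (t + inner ℝ b w) w =
        ∫ u : ℝ, (planeKernel (u - inner ℝ w b) b : ℂ) * h u w := fun b => by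
      rw [← integral_add_right_eq_self
        (fun u : ℝ => (planeKernel (u - inner ℝ w b) b : ℂ) * h u w) (inner ℝ b w)]
      simp only [real_inner_comm, add_sub_cancel_right]
    simp_rw [this]
    rw [integral_integral_swap j2]
    refine integral_congr_ae (ae_of_all _ fun u => ?_)
    simp only
    rw [integral_mul_const, integral_complex_ofReal, integral_planeKernel]
  simp_rw [hinner] at hz
  have i2 : Integrable (fun q : ℂ × ℝ =>
      ((2 * Real.pi * (q.2 * Real.exp (-q.2 ^ 2 / 2)) * Real.exp (-‖q.1‖ ^ 2 / 2) : ℝ) : ℂ) *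
        h q.2 q.1) ((volume : Measure ℂ).prod (volume : Measure ℝ)) := by
    have hi := (integrable_pow_mul_exp_neg_mul_sq 1 (one_half_pos (α := ℝ))).norm.const_mul
      (2 * Real.pi)
    refine (hG.mul_prod hi).mono' ?_ (ae_of_all _ fun q => ?_)
    · refine Continuous.aestronglyMeasurable (Continuous.mul ?_ ?_)
      · fun_prop
      · exact hcont.comp (show Continuous fun q : ℂ × ℝ => (q.2, q.1) by fun_prop)
    · rw [norm_mul, Complex.norm_real, norm_mul, norm_mul, Real.norm_of_nonneg
        (by positivity : 0 ≤ 2 * Real.pi), Real.norm_of_nonneg (Real.exp_pos (-‖q.1‖ ^ 2 / 2)).le,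
        pow_one, show -(1 / 2) * q.2 ^ 2 = -q.2 ^ 2 / 2 by ring, mul_comm (G q.1)]
      refine mul_le_mul ?_ (hle _ _) (norm_nonneg _) (by positivity)
      refine mul_le_of_le_one_right (by positivity) (Real.exp_le_one_iff.2 ?_)
      have := sq_nonneg ‖q.1‖
      linarith
  rw [integral_integral_swap i2] at hz
  have hpi : (2 * Real.pi : ℂ) ≠ 0 := by exact_mod_cast Real.two_pi_pos.ne'
  apply mul_left_cancel₀ hpi
  rw [mul_zero, ← hz, ← integral_const_mul]
  refine integral_congr_ae (ae_of_all _ fun u => ?_)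
  simp only
  rw [← mul_assoc, ← integral_const_mul]
  refine integral_congr_ae (ae_of_all _ fun w => ?_)
  simp only
  push_cast
  ring

/-- A bounded continuous function whose convolutions with the derivatives of all Gaussians vanish
is constant. -/
lemma eq_of_integral_mul_gauss_deriv_eq_zero {N : ℝ → ℂ} (hN : Continuous N) {C : ℝ}
    (hC : ∀ u, ‖N u‖ ≤ C)
    (h0 : ∀ x a : ℝ, 0 < a → ∫ u : ℝ, ((u * Real.exp (-u ^ 2 / 2) : ℝ) : ℂ) * N (x + a * u) = 0)
    (x y : ℝ) : N x = N y := by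
  have hg := integrable_pow_mul_exp_neg_mul_sq 0 (one_half_pos (α := ℝ))
  have hg1 := integrable_pow_mul_exp_neg_mul_sq 1 (one_half_pos (α := ℝ))
  have hg2 := integrable_pow_mul_exp_neg_mul_sq 2 (one_half_pos (α := ℝ))
  have he : ∀ u : ℝ, Real.exp (-(1 / 2) * u ^ 2) = Real.exp (-u ^ 2 / 2) := fun u => by
    congr 1; ring
  simp only [pow_zero, one_mul, pow_one, he] at hg hg1 hg2
  have hC0 : 0 ≤ C := (norm_nonneg _).trans (hC 0)
  -- the antiderivative
  set S : ℝ → ℂ := fun v => ∫ r in (0 : ℝ)..v, N r with hS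
  have hSd : ∀ v, HasDerivAt S (N v) v := fun v =>
    intervalIntegral.integral_hasDerivAt_right (hN.intervalIntegrable _ _)
      (hN.stronglyMeasurableAtFilter _ _) hN.continuousAt
  have hSc : Continuous S := continuous_iff_continuousAt.2 fun v => (hSd v).continuousAt
  have hSb : ∀ v, ‖S v‖ ≤ C * |v| := fun v => by
    have := intervalIntegral.norm_integral_le_of_norm_le_const (a := 0) (b := v) (f := N) (C := C)
      (fun u _ => hC u)
    simpa using this
  have hSi : ∀ x a : ℝ, Integrable
      (fun u : ℝ => ((u * Real.exp (-u ^ 2 / 2) : ℝ) : ℂ) * S (x + a * u)) := fun x a => by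
    refine (((hg1.norm.const_mul (C * |x|)).add (hg2.norm.const_mul (C * |a|)))).mono'
      (Continuous.aestronglyMeasurable (by fun_prop)) (ae_of_all _ fun u => ?_)
    simp only [Pi.add_apply, norm_mul, Complex.norm_real, norm_pow, Real.norm_eq_abs]
    have h1 : ‖S (x + a * u)‖ ≤ C * (|x| + |a| * |u|) :=
      (hSb _).trans (mul_le_mul_of_nonneg_left ((abs_add_le _ _).trans (by rw [abs_mul])) hC0)
    calc |u| * |Real.exp (-u ^ 2 / 2)| * ‖S (x + a * u)‖
        ≤ |u| * |Real.exp (-u ^ 2 / 2)| * (C * (|x| + |a| * |u|)) :=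
          mul_le_mul_of_nonneg_left h1 (by positivity)
      _ = _ := by ring
  have hNi : ∀ x a : ℝ, Integrable
      (fun u : ℝ => (Real.exp (-u ^ 2 / 2) : ℂ) * N (x + a * u)) := fun x a => by
    refine (hg.const_mul C).mono' (Continuous.aestronglyMeasurable (by fun_prop))
      (ae_of_all _ fun u => ?_)
    rw [norm_mul, Complex.norm_real, Real.norm_of_nonneg (Real.exp_pos _).le, mul_comm]
    exact mul_le_mul_of_nonneg_right (hC _) (Real.exp_pos _).le
  -- it satisfies the same equations up to constants
  have hR : ∀ a : ℝ, 0 < a → ∀ x y : ℝ,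
      ∫ u : ℝ, ((u * Real.exp (-u ^ 2 / 2) : ℝ) : ℂ) * S (x + a * u) =
        ∫ u : ℝ, ((u * Real.exp (-u ^ 2 / 2) : ℝ) : ℂ) * S (y + a * u) := fun a ha => by
    have hd : ∀ x : ℝ, HasDerivAt
        (fun x : ℝ => ∫ u : ℝ, ((u * Real.exp (-u ^ 2 / 2) : ℝ) : ℂ) * S (x + a * u)) 0 x :=
      fun x => by
      have := (hasDerivAt_integral_of_dominated_loc_of_deriv_le (μ := volume) (𝕜 := ℝ)
        (F := fun x u : ℝ => ((u * Real.exp (-u ^ 2 / 2) : ℝ) : ℂ) * S (x + a * u))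
        (F' := fun x u : ℝ => ((u * Real.exp (-u ^ 2 / 2) : ℝ) : ℂ) * N (x + a * u))
        (bound := fun u => ‖u * Real.exp (-u ^ 2 / 2)‖ * C) (x₀ := x) (s := Set.univ)
        univ_mem (Eventually.of_forall fun y =>
          Continuous.aestronglyMeasurable (by fun_prop)) (hSi x a)
        (Continuous.aestronglyMeasurable (by fun_prop))
        (ae_of_all _ fun u y _ => by
          rw [norm_mul, Complex.norm_real]
          exact mul_le_mul_of_nonneg_left (hC _) (norm_nonneg _))
        (hg1.norm.mul_const C)
        (ae_of_all _ fun u y _ => by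
          exact ((hSd (y + a * u)).comp_add_const y (a * u)).const_mul _)).2
      rwa [h0 x a ha] at this
    exact is_const_of_deriv_eq_zero (fun x => (hd x).differentiableAt) fun x => (hd x).deriv
  -- Integration by parts moves the derivative from the Gaussian to `S`. It is done with the
  -- antiderivative because `N` itself is only continuous.
  have hP : ∀ x a : ℝ, ∫ u : ℝ, ((u * Real.exp (-u ^ 2 / 2) : ℝ) : ℂ) * S (x + a * u) =
      a * ∫ u : ℝ, (Real.exp (-u ^ 2 / 2) : ℂ) * N (x + a * u) := fun x a => by
    have hbound : Integrable (fun u : ℝ => (Real.exp (-u ^ 2 / 2) : ℂ) * S (x + a * u)) := by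
      refine (((hg.norm.const_mul (C * |x|)).add (hg1.norm.const_mul (C * |a|)))).mono'
        (Continuous.aestronglyMeasurable (by fun_prop)) (ae_of_all _ fun u => ?_)
      simp only [Pi.add_apply, norm_mul, Complex.norm_real, Real.norm_eq_abs]
      have h1 : ‖S (x + a * u)‖ ≤ C * (|x| + |a| * |u|) :=
        (hSb _).trans (mul_le_mul_of_nonneg_left ((abs_add_le _ _).trans (by rw [abs_mul])) hC0)
      calc |Real.exp (-u ^ 2 / 2)| * ‖S (x + a * u)‖
          ≤ |Real.exp (-u ^ 2 / 2)| * (C * (|x| + |a| * |u|)) :=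
            mul_le_mul_of_nonneg_left h1 (by positivity)
        _ = _ := by ring
    have hd : ∀ u : ℝ, HasDerivAt (fun u : ℝ => (Real.exp (-u ^ 2 / 2) : ℂ) * S (x + a * u))
        (a * ((Real.exp (-u ^ 2 / 2) : ℂ) * N (x + a * u)) -
          ((u * Real.exp (-u ^ 2 / 2) : ℝ) : ℂ) * S (x + a * u)) u := fun u => by
      have e1 : HasDerivAt (fun u : ℝ => Real.exp (-u ^ 2 / 2))
          (-(u * Real.exp (-u ^ 2 / 2))) u := by
        have := ((((hasDerivAt_id u).pow 2).neg).div_const 2).exp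
        refine HasDerivAt.congr_deriv (f := fun u : ℝ => Real.exp (-u ^ 2 / 2)) this ?_
        simp
        ring
      have e2 : HasDerivAt (fun u : ℝ => S (x + a * u)) (a • N (x + a * u)) u := by
        have l : HasDerivAt (fun u : ℝ => x + a * u) a u := by
          simpa using ((hasDerivAt_id u).const_mul a).const_add x
        exact (hSd (x + a * u)).scomp u l
      refine HasDerivAt.congr_deriv (f := fun u : ℝ => (Real.exp (-u ^ 2 / 2) : ℂ) * S (x + a * u))
        (e1.ofReal_comp.mul e2) ?_
      rw [Complex.real_smul]
      push_cast
      ring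
    have := integral_eq_zero_of_hasDerivAt_of_integrable hd
      (((hNi x a).const_mul (a : ℂ)).sub (hSi x a)) hbound
    rw [integral_sub ((hNi x a).const_mul (a : ℂ)) (hSi x a), integral_const_mul] at this
    exact (sub_eq_zero.1 this).symm
  have hconst : ∀ a : ℝ, 0 < a → ∫ u : ℝ, (Real.exp (-u ^ 2 / 2) : ℂ) * N (x + a * u) =
      ∫ u : ℝ, (Real.exp (-u ^ 2 / 2) : ℂ) * N (y + a * u) := fun a ha => by
    have := hR a ha x y
    rw [hP, hP] at this
    exact mul_left_cancel₀ (by exact_mod_cast ha.ne') this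
  -- As the width `a` shrinks to `0`, the Gaussian average around `x` concentrates at `N x`.
  have hlim : ∀ x : ℝ, Tendsto
      (fun a : ℝ => ∫ u : ℝ, (Real.exp (-u ^ 2 / 2) : ℂ) * N (x + a * u)) (𝓝[>] 0)
      (𝓝 (∫ u : ℝ, (Real.exp (-u ^ 2 / 2) : ℂ) * N x)) := fun x => by
    refine tendsto_integral_filter_of_dominated_convergence
      (fun u => Real.exp (-u ^ 2 / 2) * C)
      (Eventually.of_forall fun a => (hNi x a).aestronglyMeasurable)
      (Eventually.of_forall fun a => ae_of_all _ fun u => ?_) (hg.mul_const C)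
      (ae_of_all _ fun u => ?_)
    · rw [norm_mul, Complex.norm_real, Real.norm_of_nonneg (Real.exp_pos _).le]
      exact mul_le_mul_of_nonneg_left (hC _) (Real.exp_pos _).le
    · have : Continuous fun a : ℝ => (Real.exp (-u ^ 2 / 2) : ℂ) * N (x + a * u) := by fun_prop
      have := this.tendsto 0
      simp only [zero_mul, add_zero] at this
      exact this.mono_left nhdsWithin_le_nhds
  have hev : ∀ᶠ a : ℝ in 𝓝[>] 0, ∫ u : ℝ, (Real.exp (-u ^ 2 / 2) : ℂ) * N (x + a * u) =
      ∫ u : ℝ, (Real.exp (-u ^ 2 / 2) : ℂ) * N (y + a * u) :=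
    eventually_mem_nhdsWithin.mono fun a ha => hconst a ha
  have heq := tendsto_nhds_unique ((hlim x).congr' hev) (hlim y)
  rw [integral_mul_const, integral_mul_const, integral_complex_ofReal] at heq
  refine mul_left_cancel₀ ?_ heq
  have hp : (∫ u : ℝ, Real.exp (-u ^ 2 / 2)) = √(Real.pi / (1 / 2)) := by
    rw [← integral_gaussian]
    simp_rw [he]
  rw [hp]
  exact_mod_cast (Real.sqrt_pos.2 (by positivity)).ne'

/-- The Gaussian average in `w` is a bounded continuous function of `u`. Moving and dilating `u`
alone in `IsPlaneNull.integral_gauss` shows that it is orthogonal to all Gaussian derivatives, hence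
constant. -/
lemma IsPlaneNull.integral_gauss_eq {h : ℝ → ℂ → ℂ} (hh : IsPlaneNull h) (u₁ u₂ : ℝ) :
    ∫ w : ℂ, (Real.exp (-‖w‖ ^ 2 / 2) : ℂ) * h u₁ w =
      ∫ w : ℂ, (Real.exp (-‖w‖ ^ 2 / 2) : ℂ) * h u₂ w := by
  obtain ⟨G, hG, hle⟩ := hh.dominated
  have hcont := hh.continuous
  have hb : ∀ u w, ‖(Real.exp (-‖w‖ ^ 2 / 2) : ℂ) * h u w‖ ≤ G w := fun u w => by
    rw [norm_mul, Complex.norm_real, Real.norm_of_nonneg (Real.exp_pos _).le]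
    refine (mul_le_of_le_one_left (norm_nonneg _) (Real.exp_le_one_iff.2 ?_)).trans (hle u w)
    have := sq_nonneg ‖w‖
    linarith
  have hmu : ∀ u, Continuous fun w : ℂ => (Real.exp (-‖w‖ ^ 2 / 2) : ℂ) * h u w := fun u =>
    Continuous.mul (by fun_prop) (hcont.comp (Continuous.prodMk_right u))
  have hmw : ∀ w, Continuous fun u : ℝ => (Real.exp (-‖w‖ ^ 2 / 2) : ℂ) * h u w := fun w =>
    Continuous.mul (by fun_prop) (hcont.comp (Continuous.prodMk_left w))
  refine eq_of_integral_mul_gauss_deriv_eq_zero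
    (N := fun u => ∫ w : ℂ, (Real.exp (-‖w‖ ^ 2 / 2) : ℂ) * h u w) (C := ∫ w, G w) ?_ ?_ ?_ u₁ u₂
  · exact continuous_of_dominated
      (fun u => (hmu u).aestronglyMeasurable)
      (fun u => ae_of_all _ (hb u)) hG (ae_of_all _ hmw)
  · exact fun u => norm_integral_le_of_norm_le hG (ae_of_all _ (hb u))
  · intro x a _
    simpa using (hh.comp_affine x a 0 one_ne_zero).integral_gauss

/-- The integrals over the planes `u = t + ⟪b, w⟫` determine a function up to a function of `w`. -/
theorem IsPlaneNull.eq {h : ℝ → ℂ → ℂ} (hh : IsPlaneNull h) (u₁ u₂ : ℝ) (w₀ : ℂ) :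
    h u₁ w₀ = h u₂ w₀ := by
  obtain ⟨G, hG, hle⟩ := hh.dominated
  have hcu : ∀ u, Continuous (h u) := fun u => hh.continuous.comp (Continuous.prodMk_right u)
  have hi : ∀ u, Integrable (h u) := fun u =>
    hG.mono' (hcu u).aestronglyMeasurable (ae_of_all _ (hle u))
  -- Gaussians concentrating at `w₀` recover the value of `h u₁ - h u₂` there, while every such
  -- average vanishes.
  have hlim := Real.tendsto_integral_gaussian_smul' ((hi u₁).sub (hi u₂))
    (v := w₀) ((hcu u₁).sub (hcu u₂)).continuousAt
  have hz : ∀ᶠ c : ℝ in atTop, ∫ w : ℂ, ((Real.pi * c : ℂ) ^ (Module.finrank ℝ ℂ / 2 : ℂ) *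
      Complex.exp (-Real.pi ^ 2 * c * ‖w₀ - w‖ ^ 2)) • (h u₁ - h u₂) w = 0 := by
    filter_upwards [eventually_gt_atTop 0] with c hc
    simp_rw [smul_eq_mul, mul_assoc]
    rw [integral_const_mul]
    refine mul_eq_zero_of_right _ ?_
    -- The dilation `r` is chosen so that `‖r (w - w₀)‖² / 2 = π² c ‖w - w₀‖²`, the exponent of the
    -- approximate identity.
    have hr : 0 < √(2 * Real.pi ^ 2 * c) := Real.sqrt_pos.2 (by positivity)
    have hr2 := Real.sq_sqrt (show 0 ≤ 2 * Real.pi ^ 2 * c by positivity)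
    set r := √(2 * Real.pi ^ 2 * c)
    have e := (hh.comp_affine 0 1 w₀ (inv_pos.2 hr).ne').integral_gauss_eq u₁ u₂
    simp only [zero_add, one_mul] at e
    have k := fun u => integral_comp_affine
      (fun w => (Real.exp (-‖r • (w - w₀)‖ ^ 2 / 2) : ℂ) * h u w) w₀ r⁻¹
    simp only [add_sub_cancel_left, smul_inv_smul₀ hr.ne'] at k
    rw [k, k] at e
    have e := smul_right_injective ℂ (abs_pos.2 (inv_pos.2 (pow_pos (inv_pos.2 hr) 2)).ne').ne' e
    have hx : ∀ w, (Real.exp (-‖r • (w - w₀)‖ ^ 2 / 2) : ℂ) =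
        Complex.exp (-((Real.pi : ℂ) ^ 2 * (c * (‖w₀ - w‖ : ℂ) ^ 2))) := fun w => by
      rw [norm_smul, Real.norm_of_nonneg hr.le, mul_pow, hr2, norm_sub_rev, Complex.ofReal_exp]
      congr 1
      push_cast
      ring
    have hbi : ∀ u, Integrable (fun w =>
        Complex.exp (-((Real.pi : ℂ) ^ 2 * (c * (‖w₀ - w‖ : ℂ) ^ 2))) * h u w) := fun u => by
      refine (hi u).bdd_mul (c := 1) (Continuous.aestronglyMeasurable (by fun_prop))
        (ae_of_all _ fun w => ?_)
      rw [← hx, Complex.norm_real, Real.norm_of_nonneg (Real.exp_pos _).le]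
      refine Real.exp_le_one_iff.2 ?_
      have := sq_nonneg ‖r • (w - w₀)‖
      linarith
    simp_rw [hx] at e
    simp only [Pi.sub_apply, neg_mul, mul_sub]
    rw [integral_sub (hbi u₁) (hbi u₂), e, sub_self]
  have := tendsto_nhds_unique (hlim.congr' hz) tendsto_const_nhds
  exact sub_eq_zero.1 this

/-! ### The gauge `λ₀ = λ̃₀ = 1` at null infinity -/

lemma gaugePair_mem_scri (sig : Signature) (w : ℂ) : gaugePair sig w ∈ Scri sig := by
  cases sig
  · refine ⟨fun h => by simpa [gaugePair] using congrFun h 0, ?_⟩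
    ext i
    fin_cases i <;> simp [gaugePair]
  · refine ⟨fun a => ?_, fun a => ?_, ?_⟩
    · fin_cases a <;> simp [gaugePair]
    · fin_cases a <;> simp [gaugePair]
    · simp [gaugePair]

lemma continuous_gaugePair (sig : Signature) : Continuous (gaugePair sig) := by
  cases sig <;> refine Continuous.prodMk ?_ ?_ <;> refine continuous_pi fun i => ?_ <;>
    fin_cases i <;> simp <;> fun_prop

lemma spinorProduct_gaugePair_zero (sig : Signature) (h : HelicitySign) (n : ℕ) (w : ℂ) :
    spinorProduct h (gaugePair sig w) (fun _ : Fin n => 0) = 1 := by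
  cases sig <;> cases h <;> simp [spinorProduct, gaugePair]

/-- Every plane `u = t + ⟪b, w⟫` is the light cone cut of a point of space-time. -/
lemma exists_contract_gaugePair_eq (sig : Signature) (t : ℝ) (b : ℂ) :
    ∃ x, IsRealVector sig x ∧
      ∀ w, (contract x (gaugePair sig w).1 (gaugePair sig w).2).re = t + inner ℝ b w := by
  cases sig
  · refine ⟨!![(t : ℂ), b / 2; star b / 2, 0], ?_, fun w => ?_⟩
    · refine Matrix.IsHermitian.ext fun i j => ?_
      fin_cases i <;> fin_cases j <;> simp
    · simp [contract, gaugePair, Fin.sum_univ_two, Complex.inner]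
      ring
  · refine ⟨!![(t : ℂ), (b.im : ℂ); (b.re : ℂ), 0], fun i j => ?_, fun w => ?_⟩
    · fin_cases i <;> fin_cases j <;> simp
    · simp [contract, gaugePair, Fin.sum_univ_two, Complex.inner]
      ring

lemma IsScaling.re_mul_pos {sig : Signature} {a a' : ℂ} (h : IsScaling sig a a') :
    0 < (a * a').re := by
  cases sig
  · obtain ⟨h0, rfl⟩ := h
    rw [Complex.star_def, Complex.mul_conj, Complex.ofReal_re]
    exact Complex.normSq_pos.2 h0
  · obtain ⟨h1, h2, h3⟩ := h
    simpa [h1] using h3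

lemma IsScaling.mul_eq_re {sig : Signature} {a a' : ℂ} (h : IsScaling sig a a') :
    a * a' = ((a * a').re : ℂ) := by
  cases sig
  · obtain ⟨h0, rfl⟩ := h
    rw [Complex.star_def, Complex.mul_conj, Complex.ofReal_re]
  · obtain ⟨h1, h2, h3⟩ := h
    apply Complex.ext <;> simp [h1, h2]

lemma exists_scaling_gaugePair {sig : Signature} {p : Spinor × Spinor} (hp : p ∈ Scri sig)
    (h0 : p.1 0 ≠ 0) : ∃ a a' w, IsScaling sig a a' ∧
      p = (a • (gaugePair sig w).1, a' • (gaugePair sig w).2) := by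
  cases sig
  · obtain ⟨-, h2⟩ := hp
    refine ⟨p.1 0, star (p.1 0), p.1 1 / p.1 0, ⟨h0, rfl⟩, Prod.ext ?_ ?_⟩
    · ext i
      fin_cases i
      · simp [gaugePair]
      · simp [gaugePair, mul_div_cancel₀ _ h0]
    · rw [h2]
      have h0' : (starRingEnd ℂ) (p.1 0) ≠ 0 := by simpa using h0
      ext i
      fin_cases i
      · simp [gaugePair]
      · simp [gaugePair, mul_div_cancel₀ _ h0']
  · obtain ⟨h1, h2, h3⟩ := hp
    have r1 : ∀ i, p.1 i = ((p.1 i).re : ℂ) := fun i => by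
      apply Complex.ext <;> simp [h1 i]
    have r2 : ∀ i, p.2 i = ((p.2 i).re : ℂ) := fun i => by
      apply Complex.ext <;> simp [h2 i]
    have n1 : ((p.1 0).re : ℂ) ≠ 0 := by exact_mod_cast (left_ne_zero_of_mul h3.ne')
    have n2 : ((p.2 0).re : ℂ) ≠ 0 := by exact_mod_cast (right_ne_zero_of_mul h3.ne')
    refine ⟨p.1 0, p.2 0, ⟨(p.1 1).re / (p.1 0).re, (p.2 1).re / (p.2 0).re⟩,
      ⟨h1 0, h2 0, h3⟩, Prod.ext ?_ ?_⟩
    · ext i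
      fin_cases i
      · simp [gaugePair]
      · simp only [gaugePair, Fin.mk_one, Pi.smul_apply, Matrix.cons_val_one, Matrix.cons_val_fin_one,
          smul_eq_mul]
        rw [r1 0, r1 1]
        push_cast
        exact (mul_div_cancel₀ _ n1).symm
    · ext i
      fin_cases i
      · simp [gaugePair]
      · simp only [gaugePair, Fin.mk_one, Pi.smul_apply, Matrix.cons_val_one, Matrix.cons_val_fin_one,
          smul_eq_mul]
        rw [r2 0, r2 1]
        push_cast
        exact (mul_div_cancel₀ _ n2).symm

/-- The gauge `λ₀ = 1` misses only the generators with `λ₀ = 0`, which occur only in Lorentz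
signature; they are reached by continuity. -/
lemma exists_seq_scri_tendsto {sig : Signature} {p : Spinor × Spinor} (hp : p ∈ Scri sig) :
    ∃ q : ℕ → Spinor × Spinor, (∀ m, q m ∈ Scri sig ∧ (q m).1 0 ≠ 0) ∧
      Tendsto q atTop (𝓝 p) := by
  by_cases h0 : p.1 0 = 0
  · cases sig
    · obtain ⟨h1, h2⟩ := hp
      have hc : Continuous fun r : ℝ => ((p.1 + Pi.single 0 (r : ℂ),
          star (p.1 + Pi.single 0 (r : ℂ))) : Spinor × Spinor) := by
        have : Continuous fun r : ℝ => (p.1 + Pi.single 0 (r : ℂ) : Spinor) :=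
          continuous_const.add ((continuous_single 0).comp Complex.continuous_ofReal)
        exact this.prodMk this.star
      refine ⟨fun m => (p.1 + Pi.single 0 ((1 / (m + 1 : ℝ) : ℝ) : ℂ),
        star (p.1 + Pi.single 0 ((1 / (m + 1 : ℝ) : ℝ) : ℂ))), fun m => ?_, ?_⟩
      · have hne : (p.1 + Pi.single 0 ((1 / (m + 1 : ℝ) : ℝ) : ℂ) : Spinor) 0 ≠ 0 := by
          rw [Pi.add_apply, h0, zero_add, Pi.single_eq_same]
          exact_mod_cast (by positivity : (1 / (m + 1 : ℝ)) ≠ 0)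
        exact ⟨⟨fun h => hne (congrFun h 0), rfl⟩, hne⟩
      · have := (hc.tendsto 0).comp (tendsto_one_div_add_atTop_nhds_zero_nat (𝕜 := ℝ))
        simpa [← h2, Function.comp_def] using this
    · exact absurd hp.2.2 (by simp [h0])
  · exact ⟨fun _ => p, fun _ => ⟨hp, h0⟩, tendsto_const_nhds⟩

/-! ### Uniqueness of the radiation data -/

/-- Such a `D` is affine. Its slope is `D (v + 1) - D v`, which tends to `0`, so `D` is a constant
with limit `0`. -/
lemma eq_zero_of_deriv_const {D : ℝ → ℂ} (hD : Differentiable ℝ D)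
    (hc : ∀ u v, deriv D u = deriv D v) (hl : Tendsto D atTop (𝓝 0)) (u : ℝ) : D u = 0 := by
  have hE : ∀ v, HasDerivAt (fun v : ℝ => D v - v • deriv D 0) 0 v := fun v => by
    have := (hD v).hasDerivAt.sub ((hasDerivAt_id v).smul_const (deriv D 0))
    rwa [hc v 0, one_smul, sub_self] at this
  have hconst := is_const_of_deriv_eq_zero (fun v => (hE v).differentiableAt) fun v => (hE v).deriv
  have hlin : ∀ v, D v = D 0 + v • deriv D 0 := fun v => by
    have := hconst v 0
    simp only [zero_smul, sub_zero] at this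
    rw [← this, sub_add_cancel]
  have hd : deriv D 0 = 0 := by
    have h1 := (hl.comp (tendsto_atTop_add_const_right atTop (1 : ℝ) tendsto_id)).sub hl
    refine tendsto_nhds_unique (tendsto_const_nhds.congr fun v => ?_) (h1.trans (by simp))
    simp only [Function.comp_apply, id_eq]
    rw [hlin (v + 1), hlin v, add_smul, one_smul]
    ring
  have : ∀ v, D u = D v := fun v => by rw [hlin u, hlin v, hd, smul_zero, smul_zero]
  exact tendsto_nhds_unique (tendsto_const_nhds.congr fun v => this v) hl

section Uniqueness

variable {sig : Signature} {h : HelicitySign} {n : ℕ} {φ : MomentumFunction}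
  {Ψ Ψ' : ScriFunction}

lemma IsCharacteristicData.continuous_deriv_gaugePair (hΨ : IsCharacteristicData sig h n Ψ) :
    Continuous (fun q : ℝ × ℂ =>
      deriv (fun v => Ψ v (gaugePair sig q.2).1 (gaugePair sig q.2).2) q.1) := by
  have hg : Continuous fun q : ℝ × ℂ => (q.1, gaugePair sig q.2) :=
    continuous_fst.prodMk ((continuous_gaugePair sig).comp continuous_snd)
  exact hΨ.continuousOn_deriv.comp_continuous hg
    fun q => ⟨trivial, gaugePair_mem_scri sig q.2⟩

lemma IsCharacteristicData.exists_bound_deriv_gaugePair (hΨ : IsCharacteristicData sig h n Ψ) :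
    ∃ G : ℂ → ℝ, Integrable G ∧ ∀ (u : ℝ) (w : ℂ),
      ‖deriv (fun v => Ψ v (gaugePair sig w).1 (gaugePair sig w).2) u‖ ≤ G w := by
  simpa only [spinorProduct_gaugePair_zero, one_mul] using hΨ.dominated fun _ => 0

lemma IsRadiationDataOf.isPlaneNull (hΨ : IsRadiationDataOf sig h n φ Ψ)
    (hΨ' : IsRadiationDataOf sig h n φ Ψ') :
    IsPlaneNull (fun u w => deriv (fun v => Ψ v (gaugePair sig w).1 (gaugePair sig w).2) u -
      deriv (fun v => Ψ' v (gaugePair sig w).1 (gaugePair sig w).2) u) := by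
  have c := hΨ.1.continuous_deriv_gaugePair
  have c' := hΨ'.1.continuous_deriv_gaugePair
  obtain ⟨G, hG, hle⟩ := hΨ.1.exists_bound_deriv_gaugePair
  obtain ⟨G', hG', hle'⟩ := hΨ'.1.exists_bound_deriv_gaugePair
  refine ⟨c.sub c', ⟨fun w => G w + G' w, hG.add hG',
    fun u w => (norm_sub_le _ _).trans (add_le_add (hle u w) (hle' u w))⟩, fun t b => ?_⟩
  obtain ⟨x, hx, hxw⟩ := exists_contract_gaugePair_eq sig t b
  have e := (hΨ.2 x hx fun _ => 0).symm.trans (hΨ'.2 x hx fun _ => 0)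
  simp only [dAdhemarField, spinorProduct_gaugePair_zero, one_mul, hxw] at e
  have e := mul_left_cancel₀ (by simp [Real.pi_ne_zero]) e
  have hl : Continuous fun w : ℂ => (t + inner ℝ b w, w) := by fun_prop
  have i := hG.mono' (c.comp hl).aestronglyMeasurable (ae_of_all _ fun w => hle _ w)
  have i' := hG'.mono' (c'.comp hl).aestronglyMeasurable (ae_of_all _ fun w => hle' _ w)
  exact (integral_sub i i').trans (sub_eq_zero.2 e)

lemma IsRadiationDataOf.eq_gaugePair (hΨ : IsRadiationDataOf sig h n φ Ψ)
    (hΨ' : IsRadiationDataOf sig h n φ Ψ') (u : ℝ) (w : ℂ) :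
    Ψ u (gaugePair sig w).1 (gaugePair sig w).2 = Ψ' u (gaugePair sig w).1 (gaugePair sig w).2 := by
  have hp := gaugePair_mem_scri sig w
  have d := hΨ.1.differentiable _ hp
  have d' := hΨ'.1.differentiable _ hp
  have hd : ∀ u, deriv (fun u => Ψ u (gaugePair sig w).1 (gaugePair sig w).2 -
      Ψ' u (gaugePair sig w).1 (gaugePair sig w).2) u =
      deriv (fun v => Ψ v (gaugePair sig w).1 (gaugePair sig w).2) u -
      deriv (fun v => Ψ' v (gaugePair sig w).1 (gaugePair sig w).2) u := fun u =>
    deriv_fun_sub (d u) (d' u)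
  have := eq_zero_of_deriv_const (d.sub d')
    (fun u v => by
      have := (hΨ.isPlaneNull hΨ').eq u v w
      rw [← hd, ← hd] at this
      exact this)
    (by rw [← sub_zero (0 : ℂ)]; exact (hΨ.1.tendsto_atTop _ hp).sub (hΨ'.1.tendsto_atTop _ hp)) u
  exact sub_eq_zero.1 this

/-- The radiation data of a massless field are unique. -/
theorem IsRadiationDataOf.eq_of_mem_scri (hΨ : IsRadiationDataOf sig h n φ Ψ)
    (hΨ' : IsRadiationDataOf sig h n φ Ψ') {p : Spinor × Spinor} (hp : p ∈ Scri sig) (u : ℝ) :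
    Ψ u p.1 p.2 = Ψ' u p.1 p.2 := by
  have key : ∀ q ∈ Scri sig, q.1 0 ≠ 0 → Ψ u q.1 q.2 = Ψ' u q.1 q.2 := fun q hq h0 => by
    obtain ⟨a, a', w, ha, rfl⟩ := exists_scaling_gaugePair hq h0
    have e := hΨ.1.weight _ (gaugePair_mem_scri sig w) a a' ha (u / (a * a').re)
    have e' := hΨ'.1.weight _ (gaugePair_mem_scri sig w) a a' ha (u / (a * a').re)
    rw [mul_div_cancel₀ _ ha.re_mul_pos.ne'] at e e'
    rw [e, e', hΨ.eq_gaugePair hΨ']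
  obtain ⟨q, hq, hl⟩ := exists_seq_scri_tendsto hp
  have hl' : Tendsto (fun m => (u, q m)) atTop (𝓝[Set.univ ×ˢ Scri sig] (u, p)) :=
    tendsto_nhdsWithin_iff.2 ⟨tendsto_const_nhds.prodMk_nhds hl,
      Eventually.of_forall fun m => ⟨trivial, (hq m).1⟩⟩
  have h1 := (hΨ.1.continuousOn (u, p) ⟨trivial, hp⟩).tendsto.comp hl'
  have h2 := (hΨ'.1.continuousOn (u, p) ⟨trivial, hp⟩).tendsto.comp hl'
  exact tendsto_nhds_unique (h1.congr fun m => key _ (hq m).1 (hq m).2) h2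

end Uniqueness

/-! ### Momenta in the direction of a generator of null infinity -/

lemma scri_subset_onShell {sig : Signature} {p : Spinor × Spinor} (hp : p ∈ Scri sig) :
    p ∈ OnShell sig := by
  cases sig
  · obtain ⟨h1, h2⟩ := hp
    obtain ⟨i, hi⟩ := Function.ne_iff.1 h1
    refine ⟨?_, fun h => ?_⟩
    · refine Matrix.IsHermitian.ext fun i j => ?_
      rw [h2]
      simp [Matrix.vecMulVec_apply, mul_comm]
    · have := congrFun (congrFun h i) i
      rw [h2, Matrix.vecMulVec_apply] at this
      simp at this
      exact hi this
  · obtain ⟨h1, h2, h3⟩ := hp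
    refine ⟨fun i j => ?_, fun h => ?_⟩
    · simp [Matrix.vecMulVec_apply, h1, h2]
    · have := congrArg Complex.re (congrFun (congrFun h 0) 0)
      rw [Matrix.vecMulVec_apply, Complex.mul_re, h1, h2] at this
      simp only [mul_zero, sub_zero, Matrix.zero_apply, Complex.zero_re] at this
      exact h3.ne' this

lemma vecMulVec_scaledPair (h : HelicitySign) (s : ℝ) (p : Spinor × Spinor) :
    Matrix.vecMulVec (scaledPair h s p).1 (scaledPair h s p).2 =
      (s : ℂ) • Matrix.vecMulVec p.1 p.2 := by
  ext i j
  cases h <;> simp [scaledPair, Matrix.vecMulVec_apply] <;> ring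

lemma scaledPair_mem_onShell {sig : Signature} (h : HelicitySign) {s : ℝ} (hs : s ≠ 0)
    {p : Spinor × Spinor} (hp : p ∈ Scri sig) : scaledPair h s p ∈ OnShell sig := by
  obtain ⟨h1, h2⟩ := scri_subset_onShell hp
  refine ⟨?_, ?_⟩
  · rw [vecMulVec_scaledPair]
    cases sig
    · refine Matrix.IsHermitian.ext fun i j => ?_
      have := h1.apply i j
      simp only [Matrix.smul_apply, smul_eq_mul, star_mul', this]
      simp
    · intro i j
      have := h1 i j
      simp only [Matrix.smul_apply, smul_eq_mul, Complex.im_ofReal_mul, this,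
        mul_zero]
  · rw [vecMulVec_scaledPair]
    exact smul_ne_zero (by exact_mod_cast hs) h2

/-- The wave function at the momentum `s λ λ̃`, in the scaling of `scaledPair`. -/
def energyAmplitude (h : HelicitySign) (φ : MomentumFunction) (p : Spinor × Spinor) (s : ℝ) : ℂ :=
  φ (scaledPair h s p).1 (scaledPair h s p).2

/-- Negative `s` is included, since the root is the principal complex one. -/
lemma sqrt_sq (s : ℝ) : ((s : ℂ) ^ (1 / 2 : ℂ)) ^ 2 = s := by
  rw [← Complex.cpow_nat_mul]
  norm_num

lemma cpow_div_two (s : ℝ) (n : ℕ) :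
    (s : ℂ) ^ ((n : ℂ) / 2) = ((s : ℂ) ^ (1 / 2 : ℂ)) ^ n := by
  rw [← Complex.cpow_nat_mul]
  congr 1
  ring

section WaveFunction

variable {sig : Signature} {h : HelicitySign} {n : ℕ} {φ : MomentumFunction}

/-- The symmetric pair `(r λ, r λ̃)` with `r² = s` is a little-group transform of `(λ, s λ̃)` by
`r`, and of `(s λ, λ̃)` by `r⁻¹`; in either case the weight is compensated by `r ^ n`. -/
lemma IsWaveFunction.sqrt_pow_mul (hφ : IsWaveFunction sig h n φ) {p : Spinor × Spinor}
    (hp : p ∈ Scri sig) {s : ℝ} (hs : s ≠ 0) :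
    ((s : ℂ) ^ (1 / 2 : ℂ)) ^ n *
      φ ((s : ℂ) ^ (1 / 2 : ℂ) • p.1) ((s : ℂ) ^ (1 / 2 : ℂ) • p.2) = energyAmplitude h φ p s := by
  have hr : (s : ℂ) ^ (1 / 2 : ℂ) ≠ 0 := fun h => by
    have := sqrt_sq s
    rw [h] at this
    exact hs (by exact_mod_cast (by simpa using this.symm : (s : ℂ) = 0))
  have hsq := sqrt_sq s
  set r := (s : ℂ) ^ (1 / 2 : ℂ)
  have hm := scaledPair_mem_onShell h hs hp
  unfold energyAmplitude
  cases h
  · have := hφ.weight _ hm r hr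
    have e : r⁻¹ • (scaledPair .neg s p).2 = r • p.2 := by
      simp only [scaledPair]
      rw [smul_smul, ← hsq]
      congr 1
      field_simp
    rw [e, helicityWeight, zpow_neg, zpow_natCast] at this
    change φ (r • p.1) (r • p.2) = _ at this
    rw [this, ← mul_assoc, mul_inv_cancel₀ (pow_ne_zero n hr), one_mul]
  · have := hφ.weight _ hm r⁻¹ (inv_ne_zero hr)
    have e : r⁻¹ • (scaledPair .pos s p).1 = r • p.1 := by
      simp only [scaledPair]
      rw [smul_smul, ← hsq]
      congr 1
      field_simp
    rw [e, inv_inv, helicityWeight, zpow_natCast, inv_pow] at this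
    change φ (r • p.1) (r • p.2) = _ at this
    rw [this, ← mul_assoc, mul_inv_cancel₀ (pow_ne_zero n hr), one_mul]

/-- A scaling `(a, a')` multiplies the momentum by the positive real `a a'`. What remains is a
little-group transformation, by `a` for negative and by `a'⁻¹` for positive helicity. -/
lemma IsWaveFunction.energyAmplitude_scaling (hφ : IsWaveFunction sig h n φ)
    {p : Spinor × Spinor} (hp : p ∈ Scri sig) {a a' : ℂ} (ha : IsScaling sig a a') {s : ℝ}
    (hs : s ≠ 0) :
    energyAmplitude h φ (a • p.1, a' • p.2) s =
      a ^ ((scriWeights n h).1 + 1) * a' ^ ((scriWeights n h).2 + 1) *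
        energyAmplitude h φ p (s * (a * a').re) := by
  have hr := ha.mul_eq_re
  have hpos := ha.re_mul_pos
  have hm := scaledPair_mem_onShell h (mul_ne_zero hs hpos.ne') hp
  have hne : a * a' ≠ 0 := by
    rw [hr]
    exact_mod_cast hpos.ne'
  have ha0 := left_ne_zero_of_mul hne
  have ha0' := right_ne_zero_of_mul hne
  set r := (a * a').re
  unfold energyAmplitude
  cases h
  · have := hφ.weight _ hm a ha0
    have e : a⁻¹ • (scaledPair .neg (s * r) p).2 = (s : ℂ) • a' • p.2 := by
      simp only [scaledPair]
      rw [smul_smul, smul_smul, Complex.ofReal_mul, ← hr]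
      congr 1
      field_simp
    rw [e] at this
    have e1 : a ^ ((scriWeights n .neg).1 + 1) * a' ^ ((scriWeights n .neg).2 + 1) =
        a ^ helicityWeight n .neg := by simp [scriWeights, helicityWeight]
    rw [e1]
    exact this
  · have := hφ.weight _ hm a'⁻¹ (inv_ne_zero ha0')
    have e : a'⁻¹ • (scaledPair .pos (s * r) p).1 = (s : ℂ) • a • p.1 := by
      simp only [scaledPair]
      rw [smul_smul, smul_smul, Complex.ofReal_mul, ← hr]
      congr 1
      field_simp
    rw [e, inv_inv] at this
    have e1 : a ^ ((scriWeights n .pos).1 + 1) * a' ^ ((scriWeights n .pos).2 + 1) =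
        a'⁻¹ ^ helicityWeight n .pos := by simp [scriWeights, helicityWeight]
    rw [e1]
    exact this

lemma IsWaveFunction.continuousOn_energyAmplitude (hφ : IsWaveFunction sig h n φ) :
    ContinuousOn (fun q : ℝ × (Spinor × Spinor) => energyAmplitude h φ q.2 q.1)
      ({0}ᶜ ×ˢ Scri sig) := by
  refine hφ.continuousOn.comp (f := fun q : ℝ × (Spinor × Spinor) => scaledPair h q.1 q.2) ?_
    fun q hq => scaledPair_mem_onShell h hq.1 hq.2
  refine Continuous.continuousOn ?_
  cases h <;> unfold scaledPair <;> fun_prop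

lemma ae_real_ne_zero : ∀ᵐ s : ℝ, s ≠ 0 := by simp [ae_iff]

lemma IsWaveFunction.aestronglyMeasurable_energyAmplitude (hφ : IsWaveFunction sig h n φ)
    {p : Spinor × Spinor} (hp : p ∈ Scri sig) :
    AEStronglyMeasurable (energyAmplitude h φ p) := by
  have hc : ContinuousOn (energyAmplitude h φ p) {0}ᶜ :=
    hφ.continuousOn_energyAmplitude.comp (f := fun s : ℝ => (s, p))
      (by fun_prop) fun s hs => ⟨hs, hp⟩
  have := hc.aestronglyMeasurable (μ := volume) (measurableSet_singleton (0 : ℝ)).compl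
  rwa [Measure.restrict_eq_self_of_ae_mem] at this
  exact ae_real_ne_zero

lemma IsWaveFunction.integrable_mul_energyAmplitude (hφ : IsWaveFunction sig h n φ)
    {p : Spinor × Spinor} (hp : p ∈ Scri sig) {c : ℝ → ℂ} (hc : Continuous c)
    (hcb : ∀ s, ‖c s‖ ≤ 1 + |s|) : Integrable (fun s => c s * energyAmplitude h φ p s) := by
  obtain ⟨g, hg, hle⟩ := hφ.dominated {p} (by simpa using hp) isCompact_singleton
  refine hg.mono' (hc.aestronglyMeasurable.mul (hφ.aestronglyMeasurable_energyAmplitude hp)) ?_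
  filter_upwards [ae_real_ne_zero] with s hs
  rw [norm_mul]
  exact (mul_le_mul_of_nonneg_right (hcb s) (norm_nonneg _)).trans (hle p rfl s hs)

lemma norm_exp_neg_I_mul (s u : ℝ) : ‖Complex.exp (-Complex.I * s * u)‖ = 1 := by
  rw [show -Complex.I * s * u = ((-(s * u) : ℝ) : ℂ) * Complex.I by push_cast; ring,
    Complex.norm_exp_ofReal_mul_I]

lemma IsWaveFunction.integrable_energyAmplitude_mul_exp (hφ : IsWaveFunction sig h n φ)
    {p : Spinor × Spinor} (hp : p ∈ Scri sig) (u : ℝ) :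
    Integrable (fun s : ℝ => energyAmplitude h φ p s * Complex.exp (-Complex.I * s * u)) := by
  have := hφ.integrable_mul_energyAmplitude hp (c := fun s => Complex.exp (-Complex.I * s * u))
    (by fun_prop) fun s => by rw [norm_exp_neg_I_mul]; linarith [abs_nonneg s]
  simpa only [mul_comm] using this

lemma IsWaveFunction.continuousOn_integral_mul_energyAmplitude (hφ : IsWaveFunction sig h n φ)
    {c : ℝ → ℂ} (hc : Continuous c) (hcb : ∀ s, ‖c s‖ ≤ 1 + |s|) :
    ContinuousOn (fun q : ℝ × (Spinor × Spinor) =>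
      ∫ s : ℝ, c s * energyAmplitude h φ q.2 s * Complex.exp (-Complex.I * s * q.1))
      (Set.univ ×ˢ Scri sig) := by
  intro q hq
  -- Sequences suffice, and a convergent sequence in `Scri sig` together with its limit is a compact
  -- set, to which the domination hypothesis applies. The first `N` terms, which may lie outside,
  -- are dropped.
  refine tendsto_of_seq_tendsto fun y hy => ?_
  obtain ⟨hy1, hy2⟩ := tendsto_nhdsWithin_iff.1 hy
  obtain ⟨N, hN⟩ := eventually_atTop.1 hy2
  refine (tendsto_add_atTop_iff_nat N).1 ?_
  have hz : Tendsto (fun m => y (m + N)) atTop (𝓝 q) := (tendsto_add_atTop_iff_nat N).2 hy1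
  have hz2 : Tendsto (fun m => (y (m + N)).2) atTop (𝓝 q.2) := (continuous_snd.tendsto q).comp hz
  have hzS : ∀ m, (y (m + N)).2 ∈ Scri sig := fun m => (hN _ (by omega)).2
  obtain ⟨g, hg, hle⟩ := hφ.dominated (insert q.2 (Set.range fun m => (y (m + N)).2))
    (Set.insert_subset hq.2 (Set.range_subset_iff.2 hzS)) hz2.isCompact_insert_range
  refine tendsto_integral_of_dominated_convergence g (fun m => ?_) hg (fun m => ?_) ?_
  · exact (hc.aestronglyMeasurable.mul
      (hφ.aestronglyMeasurable_energyAmplitude (hzS m))).mul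
        (Continuous.aestronglyMeasurable (by fun_prop))
  · filter_upwards [ae_real_ne_zero] with s hs
    rw [norm_mul, norm_mul, norm_exp_neg_I_mul, mul_one]
    exact (mul_le_mul_of_nonneg_right (hcb s) (norm_nonneg _)).trans
      (hle _ (Or.inr ⟨m, rfl⟩) s hs)
  · filter_upwards [ae_real_ne_zero] with s hs
    have hA := (hφ.continuousOn_energyAmplitude (s, q.2) ⟨hs, hq.2⟩).tendsto.comp
      (tendsto_nhdsWithin_iff.2 ⟨tendsto_const_nhds.prodMk_nhds hz2,
        Eventually.of_forall fun m => ⟨hs, hzS m⟩⟩)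
    have hE : Continuous fun q : ℝ × (Spinor × Spinor) => Complex.exp (-Complex.I * s * q.1) := by
      fun_prop
    exact (tendsto_const_nhds.mul hA).mul ((hE.tendsto q).comp hz)

/-! ### Existence of the radiation data -/

/-- The energy Fourier transform of the wave function along the generators of null infinity. -/
def radiationData (h : HelicitySign) (φ : MomentumFunction) : ScriFunction := fun u l lt =>
  Complex.I * ∫ s : ℝ, energyAmplitude h φ (l, lt) s * Complex.exp (-Complex.I * s * u)

/-- The factor `1 + |s|` in the domination hypothesis permits differentiation under the integral,
and `i · (-i s) = s`. -/
lemma IsWaveFunction.hasDerivAt_radiationData (hφ : IsWaveFunction sig h n φ)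
    {p : Spinor × Spinor} (hp : p ∈ Scri sig) (u : ℝ) :
    HasDerivAt (fun u => radiationData h φ u p.1 p.2)
      (∫ s : ℝ, (s : ℂ) * energyAmplitude h φ p s * Complex.exp (-Complex.I * s * u)) u := by
  have hs := hφ.integrable_mul_energyAmplitude hp (c := fun s => (s : ℂ))
    Complex.continuous_ofReal fun s => by
      rw [Complex.norm_real, Real.norm_eq_abs]; linarith
  have hm := hφ.aestronglyMeasurable_energyAmplitude hp
  have := (hasDerivAt_integral_of_dominated_loc_of_deriv_le (α := ℝ) (μ := volume) (𝕜 := ℝ)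
    (F := fun (u s : ℝ) => energyAmplitude h φ p s * Complex.exp (-Complex.I * s * u))
    (F' := fun (u s : ℝ) => energyAmplitude h φ p s *
      (Complex.exp (-Complex.I * s * u) * (-Complex.I * s)))
    (bound := fun s : ℝ => ‖(s : ℂ) * energyAmplitude h φ p s‖) (x₀ := u) (s := Set.univ)
    univ_mem (Eventually.of_forall fun v =>
      (hφ.integrable_energyAmplitude_mul_exp hp v).aestronglyMeasurable)
    (hφ.integrable_energyAmplitude_mul_exp hp u)
    (hm.mul (Continuous.aestronglyMeasurable (by fun_prop)))
    (ae_of_all _ fun s v _ => by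
      rw [norm_mul, norm_mul, norm_exp_neg_I_mul, norm_mul, norm_mul, norm_neg, Complex.norm_I,
        one_mul, one_mul, mul_comm])
    hs.norm
    (ae_of_all _ fun s v _ => by
      have h0 : HasDerivAt (fun v : ℝ => (v : ℂ)) 1 v := Complex.ofRealCLM.hasDerivAt
      have := ((h0.const_mul (-Complex.I * s)).cexp).const_mul (energyAmplitude h φ p s)
      rwa [mul_one] at this)).2
  refine (this.const_mul Complex.I).congr_deriv ?_
  rw [← integral_const_mul]
  refine integral_congr_ae (ae_of_all _ fun s => ?_)
  simp only
  linear_combination (-(s : ℂ) * energyAmplitude h φ p s * Complex.exp (-Complex.I * s * u)) *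
    Complex.I_sq

/-- The amplitude has both weights one higher than the data; the Jacobian `(a a')⁻¹` of the
substitution `s ↦ s a a'` lowers each by one. -/
lemma IsWaveFunction.radiationData_weight (hφ : IsWaveFunction sig h n φ)
    {p : Spinor × Spinor} (hp : p ∈ Scri sig) {a a' : ℂ} (ha : IsScaling sig a a') (u : ℝ) :
    radiationData h φ ((a * a').re * u) (a • p.1) (a' • p.2) =
      a ^ (scriWeights n h).1 * a' ^ (scriWeights n h).2 * radiationData h φ u p.1 p.2 := by
  have hr := ha.mul_eq_re
  have hpos := ha.re_mul_pos
  have hne : a * a' ≠ 0 := by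
    rw [hr]
    exact_mod_cast hpos.ne'
  have ha0 := left_ne_zero_of_mul hne
  have ha0' := right_ne_zero_of_mul hne
  have e : ∫ s : ℝ, energyAmplitude h φ (a • p.1, a' • p.2) s *
        Complex.exp (-Complex.I * s * ((a * a').re * u : ℝ)) =
      ∫ s : ℝ, (a ^ ((scriWeights n h).1 + 1) * a' ^ ((scriWeights n h).2 + 1)) *
        (energyAmplitude h φ p (s * (a * a').re) *
          Complex.exp (-Complex.I * ((s * (a * a').re : ℝ) : ℂ) * u)) := by
    refine integral_congr_ae ?_
    filter_upwards [ae_real_ne_zero] with s hs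
    rw [hφ.energyAmplitude_scaling hp ha hs, mul_assoc]
    congr 3
    push_cast
    ring
  unfold radiationData
  rw [e, integral_const_mul, Measure.integral_comp_mul_right
    (fun s : ℝ => energyAmplitude h φ p s * Complex.exp (-Complex.I * s * u)),
    abs_of_pos (inv_pos.2 hpos), Complex.real_smul, Complex.ofReal_inv, ← hr,
    zpow_add_one₀ ha0, zpow_add_one₀ ha0']
  change _ = _ * (Complex.I * ∫ s : ℝ, energyAmplitude h φ p s * Complex.exp (-Complex.I * s * u))
  generalize (∫ s : ℝ, energyAmplitude h φ p s * Complex.exp (-Complex.I * s * u)) = J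
  field_simp

/-- The Riemann–Lebesgue lemma, after rescaling `u` by `2π`. No hypothesis on `φ` is needed, because
a non-integrable amplitude has integral `0` by convention. -/
lemma tendsto_radiationData (h : HelicitySign) (φ : MomentumFunction) (p : Spinor × Spinor) :
    Tendsto (fun u => radiationData h φ u p.1 p.2) (cocompact ℝ) (𝓝 0) := by
  have h1 := Real.tendsto_integral_exp_smul_cocompact (energyAmplitude h φ p)
  have h2 : Tendsto (fun u : ℝ => u * (2 * Real.pi)⁻¹) (cocompact ℝ) (cocompact ℝ) :=
    (Homeomorph.mulRight₀ (2 * Real.pi)⁻¹ (by positivity)).isClosedEmbedding.tendsto_cocompact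
  have h3 := (h1.comp h2).const_mul Complex.I
  rw [mul_zero] at h3
  refine h3.congr fun u => ?_
  unfold radiationData
  congr 1
  refine integral_congr_ae (ae_of_all _ fun s => ?_)
  simp only
  rw [Circle.smul_def, Real.fourierChar_apply, smul_eq_mul, mul_comm]
  congr 2
  push_cast
  have : (Real.pi : ℂ) ≠ 0 := by exact_mod_cast Real.pi_ne_zero
  field_simp

lemma spinorProduct_momentumPair_mul (hφ : IsWaveFunction sig h n φ) {ω : ℝ} (hω : ω ≠ 0) (w : ℂ)
    (A : Fin n → Fin 2) :
    spinorProduct h (momentumPair sig ω w) A *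
        φ (momentumPair sig ω w).1 (momentumPair sig ω w).2 =
      spinorProduct h (gaugePair sig w) A * energyAmplitude h φ (gaugePair sig w) ω := by
  rw [← hφ.sqrt_pow_mul (gaugePair_mem_scri sig w) hω, ← mul_assoc]
  congr 1
  cases h <;> simp [spinorProduct, momentumPair, Finset.prod_mul_distrib, mul_comm]

lemma contract_momentumPair (x : Matrix (Fin 2) (Fin 2) ℂ) (ω : ℝ) (w : ℂ) :
    contract x (momentumPair sig ω w).1 (momentumPair sig ω w).2 =
      ω * contract x (gaugePair sig w).1 (gaugePair sig w).2 := by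
  rw [← sqrt_sq ω]
  simp only [contract, momentumPair, Finset.mul_sum, Pi.smul_apply, smul_eq_mul]
  refine Finset.sum_congr rfl fun a _ => Finset.sum_congr rfl fun b _ => ?_
  rw [sqrt_sq]
  linear_combination (x a b * (gaugePair sig w).1 a * (gaugePair sig w).2 b) * sqrt_sq ω

lemma contract_gaugePair_eq_re {x : Matrix (Fin 2) (Fin 2) ℂ} (hx : IsRealVector sig x) (w : ℂ) :
    contract x (gaugePair sig w).1 (gaugePair sig w).2 =
      ((contract x (gaugePair sig w).1 (gaugePair sig w).2).re : ℂ) := by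
  have : (contract x (gaugePair sig w).1 (gaugePair sig w).2).im = 0 := by
    cases sig
    · have h00 := congrArg Complex.im (hx.apply 0 0)
      have h11 := congrArg Complex.im (hx.apply 1 1)
      have h01 := hx.apply 0 1
      have e00 : (x 0 0).im = 0 := by simp at h00; linarith
      have e11 : (x 1 1).im = 0 := by simp at h11; linarith
      simp [contract, gaugePair, Fin.sum_univ_two, e00, e11, ← h01]
      ring
    · have hx' : ∀ i j, (x i j).im = 0 := hx
      simp [contract, gaugePair, Fin.sum_univ_two, hx']
  apply Complex.ext <;> simp [this]

theorem IsWaveFunction.isCharacteristicData_radiationData (hφ : IsWaveFunction sig h n φ) :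
    IsCharacteristicData sig h n (radiationData h φ) where
  weight p hp a a' ha u := hφ.radiationData_weight hp ha u
  differentiable p hp u := (hφ.hasDerivAt_radiationData hp u).differentiableAt
  continuousOn := by
    have := (hφ.continuousOn_integral_mul_energyAmplitude (c := fun _ => 1) continuous_const
      fun s => by rw [norm_one]; linarith [abs_nonneg s]).const_mul Complex.I
    simp only [one_mul] at this
    exact this
  continuousOn_deriv := by
    refine (hφ.continuousOn_integral_mul_energyAmplitude (c := fun s => (s : ℂ))
      Complex.continuous_ofReal fun s => by
        rw [Complex.norm_real, Real.norm_eq_abs]; linarith).congr fun q hq => ?_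
    exact (hφ.hasDerivAt_radiationData hq.2 q.1).deriv
  tendsto_atTop p _ := (tendsto_radiationData h φ p).mono_left atTop_le_cocompact
  tendsto_atBot p _ := (tendsto_radiationData h φ p).mono_left atBot_le_cocompact
  dominated A := by
    -- The bound is the `ω`-integral of the modulus of the momentum-space integrand. It does not
    -- depend on `u`, because `u` enters only through a phase.
    refine ⟨_, (hφ.integrable A).integral_norm_prod_right, fun u w => ?_⟩
    rw [(hφ.hasDerivAt_radiationData (gaugePair_mem_scri sig w) u).deriv, ← integral_const_mul]
    refine (norm_integral_le_integral_norm _).trans (le_of_eq ?_)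
    refine integral_congr_ae ?_
    filter_upwards [ae_real_ne_zero] with s hs
    rw [spinorProduct_momentumPair_mul hφ hs]
    simp only [norm_mul, norm_exp_neg_I_mul]
    ring

/-- Fubini with the energy integral inside: along the direction `w` it is the `u`-derivative of the
radiation data at `u = x·z z̃`, a real number because `x` is real. -/
theorem IsWaveFunction.fourierField_eq_dAdhemarField (hφ : IsWaveFunction sig h n φ)
    {x : Matrix (Fin 2) (Fin 2) ℂ} (hx : IsRealVector sig x) (A : Fin n → Fin 2) :
    fourierField sig h φ x A = dAdhemarField sig h (radiationData h φ) x A := by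
  unfold fourierField dAdhemarField
  congr 1
  have hcg := continuous_gaugePair sig
  have hcx : Continuous fun w : ℂ => contract x (gaugePair sig w).1 (gaugePair sig w).2 := by
    unfold contract
    fun_prop
  have hexp : ∀ q : ℝ × ℂ, Complex.exp (-Complex.I *
      contract x (momentumPair sig q.1 q.2).1 (momentumPair sig q.1 q.2).2) =
      Complex.exp (-Complex.I * q.1 *
        ((contract x (gaugePair sig q.2).1 (gaugePair sig q.2).2).re : ℂ)) := fun q => by
    rw [contract_momentumPair, contract_gaugePair_eq_re hx, mul_assoc, Complex.ofReal_re]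
  have hi : Integrable (fun q : ℝ × ℂ => spinorProduct h (momentumPair sig q.1 q.2) A *
      φ (momentumPair sig q.1 q.2).1 (momentumPair sig q.1 q.2).2 *
      Complex.exp (-Complex.I *
        contract x (momentumPair sig q.1 q.2).1 (momentumPair sig q.1 q.2).2) * (q.1 : ℂ))
      ((volume : Measure ℝ).prod (volume : Measure ℂ)) := by
    have := (hφ.integrable A).bdd_mul (c := 1) (f := fun q : ℝ × ℂ =>
      Complex.exp (-Complex.I * q.1 *
        ((contract x (gaugePair sig q.2).1 (gaugePair sig q.2).2).re : ℂ)))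
      (Continuous.cexp ((continuous_const.mul (Complex.continuous_ofReal.comp continuous_fst)).mul
        (Complex.continuous_ofReal.comp
          (Complex.continuous_re.comp (hcx.comp continuous_snd))))).aestronglyMeasurable
      (ae_of_all _ fun q => (norm_exp_neg_I_mul _ _).le)
    refine this.congr (ae_of_all _ fun q => ?_)
    simp only
    rw [hexp]
    ring
  rw [Measure.volume_eq_prod, integral_prod_symm _ hi]
  refine integral_congr_ae (ae_of_all _ fun w => ?_)
  simp only
  rw [(hφ.hasDerivAt_radiationData (gaugePair_mem_scri sig w) _).deriv, ← integral_const_mul]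
  refine integral_congr_ae ?_
  filter_upwards [ae_real_ne_zero] with s hs
  rw [hexp (s, w), spinorProduct_momentumPair_mul hφ hs]
  ring

theorem IsWaveFunction.isRadiationDataOf_radiationData (hφ : IsWaveFunction sig h n φ) :
    IsRadiationDataOf sig h n φ (radiationData h φ) :=
  ⟨hφ.isCharacteristicData_radiationData, fun _ hx A => hφ.fourierField_eq_dAdhemarField hx A⟩

theorem IsWaveFunction.radiationData_unique_formula (hφ : IsWaveFunction sig h n φ)
    {Ψ : ScriFunction} (hΨ : IsRadiationDataOf sig h n φ Ψ) {l lt : Spinor}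
    (hp : (l, lt) ∈ Scri sig) (u : ℝ) :
    Integrable (fun s : ℝ => energyAmplitude h φ (l, lt) s * Complex.exp (-Complex.I * s * u)) ∧
    Ψ u l lt =
      Complex.I * ∫ s : ℝ, energyAmplitude h φ (l, lt) s * Complex.exp (-Complex.I * s * u) ∧
    Integrable (fun s : ℝ => (s : ℂ) ^ ((n : ℂ) / 2) *
      φ ((s : ℂ) ^ (1 / 2 : ℂ) • l) ((s : ℂ) ^ (1 / 2 : ℂ) • lt) *
        Complex.exp (-Complex.I * s * u)) ∧
    Ψ u l lt = Complex.I * ∫ s : ℝ, (s : ℂ) ^ ((n : ℂ) / 2) *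
      φ ((s : ℂ) ^ (1 / 2 : ℂ) • l) ((s : ℂ) ^ (1 / 2 : ℂ) • lt) *
        Complex.exp (-Complex.I * s * u) := by
  have hi := hφ.integrable_energyAmplitude_mul_exp hp u
  have heq : Ψ u l lt = radiationData h φ u l lt :=
    hΨ.eq_of_mem_scri hφ.isRadiationDataOf_radiationData hp u
  -- The integrands may differ at `s = 0`, where the momentum vanishes and the weight condition says
  -- nothing.
  have hae : (fun s : ℝ => energyAmplitude h φ (l, lt) s * Complex.exp (-Complex.I * s * u)) =ᵐ[volume]
      fun s : ℝ => (s : ℂ) ^ ((n : ℂ) / 2) *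
        φ ((s : ℂ) ^ (1 / 2 : ℂ) • l) ((s : ℂ) ^ (1 / 2 : ℂ) • lt) *
          Complex.exp (-Complex.I * s * u) := by
    filter_upwards [ae_real_ne_zero] with s hs
    rw [← hφ.sqrt_pow_mul hp hs, cpow_div_two]
  exact ⟨hi, heq, hi.congr hae, by rw [heq, radiationData, integral_congr_ae hae]⟩

end WaveFunction

end NullInfinity

end

theorem mainTheorem1 (sig : Signature) (n : ℕ) (φ : MomentumFunction) :
    (IsWaveFunction sig .neg n φ →
      (∃ Ψ : ScriFunction, IsRadiationDataOf sig .neg n φ Ψ) ∧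
      ∀ Ψ : ScriFunction, IsRadiationDataOf sig .neg n φ Ψ →
        ∀ (l lt : Spinor), (l, lt) ∈ Scri sig → ∀ u : ℝ,
          Integrable (fun s : ℝ => φ l ((s : ℂ) • lt) * Complex.exp (-Complex.I * s * u)) ∧
          Ψ u l lt = Complex.I * ∫ s : ℝ, φ l ((s : ℂ) • lt) * Complex.exp (-Complex.I * s * u) ∧
          Integrable (fun s : ℝ => (s : ℂ) ^ ((n : ℂ) / 2) *
            φ ((s : ℂ) ^ (1 / 2 : ℂ) • l) ((s : ℂ) ^ (1 / 2 : ℂ) • lt) *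
              Complex.exp (-Complex.I * s * u)) ∧
          Ψ u l lt = Complex.I * ∫ s : ℝ, (s : ℂ) ^ ((n : ℂ) / 2) *
            φ ((s : ℂ) ^ (1 / 2 : ℂ) • l) ((s : ℂ) ^ (1 / 2 : ℂ) • lt) *
              Complex.exp (-Complex.I * s * u)) ∧
    (IsWaveFunction sig .pos n φ →
      (∃ Ψ : ScriFunction, IsRadiationDataOf sig .pos n φ Ψ) ∧
      ∀ Ψ : ScriFunction, IsRadiationDataOf sig .pos n φ Ψ →
        ∀ (l lt : Spinor), (l, lt) ∈ Scri sig → ∀ u : ℝ,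
          Integrable (fun s : ℝ => φ ((s : ℂ) • l) lt * Complex.exp (-Complex.I * s * u)) ∧
          Ψ u l lt = Complex.I * ∫ s : ℝ, φ ((s : ℂ) • l) lt * Complex.exp (-Complex.I * s * u) ∧
          Integrable (fun s : ℝ => (s : ℂ) ^ ((n : ℂ) / 2) *
            φ ((s : ℂ) ^ (1 / 2 : ℂ) • l) ((s : ℂ) ^ (1 / 2 : ℂ) • lt) *
              Complex.exp (-Complex.I * s * u)) ∧
          Ψ u l lt = Complex.I * ∫ s : ℝ, (s : ℂ) ^ ((n : ℂ) / 2) *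
            φ ((s : ℂ) ^ (1 / 2 : ℂ) • l) ((s : ℂ) ^ (1 / 2 : ℂ) • lt) *
              Complex.exp (-Complex.I * s * u)) := by
  exact ⟨fun hφ => ⟨⟨_, hφ.isRadiationDataOf_radiationData⟩, fun _ hΨ _ _ hp u =>
      hφ.radiationData_unique_formula hΨ hp u⟩,
    fun hφ => ⟨⟨_, hφ.isRadiationDataOf_radiationData⟩, fun _ hΨ _ _ hp u =>
      hφ.radiationData_unique_formula hΨ hp u⟩⟩
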